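/- Let $S^2\subset\mathbb{R}^3$ be the unit sphere with its round metric, surface measure and Laplace–Beltrami operator $\Delta$. For a real function $\psi$ on $S^2$ write $\psi_+=\max(\psi,0)$ and $\psi_-=\max(-\psi,0)$ for its positive and negative parts, and let $\|\cdot\|_p$ be the $L^p$ norm on $S^2$ with respect to the surface measure (the essential supremum norm if $p=\infty$). Let $P_m$ be the $m$-th Legendre polynomial and $\theta$ the angle to the north pole. For every $p\in[6,\infty]$ there is a sequence $(\psi_n)_{n\ge 1}$ of eigenfunctions of the Laplacian on $S^2$, $-\Delta\psi_n=\lambda_n\psi_n$, with $\lambda_n\to\infty$ as $n\to\infty$, such that the limit $$\lim_{n\to\infty}\frac{\|\psi_{n,+}\|_p}{\|\psi_{n,-}\|_p}$$ exists, is finite, and is $>1$. Moreover, the $\psi_n$ may be taken to be the even zonal spherical harmonics $\psi_n=P_{4n}(\cos\theta)$, $n\ge 1$. -/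

import Mathlib

open MeasureTheory Filter Topology
open scoped ENNReal Manifold ContDiff

noncomputable section

/-- The unit sphere `S²` in Euclidean three-space. -/
abbrev S2 : Type := Metric.sphere (0 : EuclideanSpace ℝ (Fin 3)) 1

/-- The surface measure on `S²` (the area measure of the round metric, of total mass `4π`). -/
def surfaceMeasure : Measure S2 :=
  (volume : Measure (EuclideanSpace ℝ (Fin 3))).toSphere

open scoped Classical in
/-- The extension of `f : S² → ℝ` that is constant along rays from the origin,
`x ↦ f (x / ‖x‖)`; the value `0` at the origin plays no role. -/
def radialExtension (f : S2 → ℝ) (x : EuclideanSpace ℝ (Fin 3)) : ℝ :=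
  if hx : x = 0 then 0
  else f ⟨‖x‖⁻¹ • x, by simp [norm_smul, hx]⟩

/-- The Laplace–Beltrami operator of the round metric on `S²`: the Euclidean Laplacian
of the extension that is constant along rays, evaluated on the sphere. -/
def sphereLaplacian (f : S2 → ℝ) (x : S2) : ℝ :=
  Laplacian.laplacian (radialExtension f) (x : EuclideanSpace ℝ (Fin 3))

/-- `f` is an eigenfunction of the Laplacian on `S²` with eigenvalue `μ`:
it is smooth, not identically zero, and `-Δ f = μ f`. -/
structure IsLaplaceEigenfunction (f : S2 → ℝ) (μ : ℝ) : Prop where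
  smooth : ContMDiff (𝓡 2) 𝓘(ℝ, ℝ) ∞ f
  ne_zero : f ≠ 0
  eigen : ∀ x, -sphereLaplacian f x = μ * f x

/-- The Legendre polynomial `P_n`, by Rodrigues' formula. -/
def legendreP (n : ℕ) : Polynomial ℝ :=
  Polynomial.C (1 / (2 ^ n * (n.factorial : ℝ))) *
    Polynomial.derivative^[n] ((Polynomial.X ^ 2 - 1) ^ n)

/-- The zonal spherical harmonic `P_n(cos θ)`, where `θ` is the angle to the north pole,
so that `cos θ` is the third coordinate. -/
def zonalHarmonic (n : ℕ) (x : S2) : ℝ :=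
  (legendreP n).eval ((x : EuclideanSpace ℝ (Fin 3)) 2)

/-- The `L^p` norm on `S²` with respect to the surface measure (the essential supremum of the
absolute value when `p = ∞`). -/
def sphereLpNorm (f : S2 → ℝ) (p : ℝ≥0∞) : ℝ :=
  (eLpNorm f p surfaceMeasure).toReal

end

/-! For even m, P_m(cos θ) has its maximum 1 at both poles, and near a pole it looks like the Bessel
function J₀, whose central positive peak outweighs its negative wells in high L^p norms. Put N =
m(m+1) and t = cos θ = 1 - 2y/N. The rescaled polynomial w_m(y) = P_m(t) has Taylor coefficients
converging to those of J₀(2√y), with the uniform majorant 1/(k!)² (`tendsto_rescaledCoeff`,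
`abs_rescaledCoeff_le`).

For finite p = a, the hat-box theorem and parity turn both norms into integrals of w_m over [0, N/2]
with the same prefactor, which cancels in the ratio. A Sonin energy for the Legendre equation gives
√y w_m(y)² ≤ 1 on 1 ≤ y ≤ N/2 for large m, hence the envelope y^(-a/4), integrable for a > 4. By
dominated convergence the ratio tends to (A/B)^(1/a), with A and B the integrals of the a-th powers
of the positive and negative parts of J₀(2√y).

To see that A > B for a ≥ 6: J₀(2√y) ≥ 1 - y on [0,1] gives A ≥ 1/(a+1), while the limiting bound √y
J₀(2√y)² ≤ 2/5 on y ≥ 1 gives B ≤ (2/5)^(a/2)/(a/4 - 1). For p = ∞ the positive norm is 1, and the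
negative norm tends to the depth of the deepest well, at most √(2/5). -/

/-! ### Legendre polynomials expanded at t = 1, and their differential equation -/

open Polynomial in
/-- The shifted Legendre polynomial with real coefficients. -/
noncomputable def realShiftedLegendre (m : ℕ) : ℝ[X] :=
  (shiftedLegendre m).map (Int.castRingHom ℝ)

theorem realShiftedLegendre_coeff (m k : ℕ) :
    (realShiftedLegendre m).coeff k = (-1) ^ k * m.choose k * (m + k).choose m := by
  simp [realShiftedLegendre, Polynomial.coeff_shiftedLegendre]

theorem realShiftedLegendre_natDegree_le (m : ℕ) : (realShiftedLegendre m).natDegree ≤ m := by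
  refine Polynomial.natDegree_map_le.trans ?_
  simp

theorem realShiftedLegendre_eval_symm (m : ℕ) (x : ℝ) :
    (realShiftedLegendre m).eval x = (-1) ^ m * (realShiftedLegendre m).eval (1 - x) := by
  have h := Polynomial.shiftedLegendre_eval_symm m x
  simpa [realShiftedLegendre, Polynomial.eval_map, Polynomial.aeval_def] using h

open Polynomial in
theorem iterate_derivative_comp_one_sub_two_mul_X (p : ℝ[X]) (n : ℕ) :
    derivative^[n] (p.comp (1 - C 2 * X)) =
      C ((-2) ^ n) * (derivative^[n] p).comp (1 - C 2 * X) := by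
  induction n with
  | zero => simp
  | succ n ih =>
    rw [Function.iterate_succ_apply', ih, Function.iterate_succ_apply', derivative_C_mul,
      derivative_comp, pow_succ]
    simp only [derivative_sub, derivative_one, derivative_C_mul, derivative_X, C_mul, C_neg]
    ring

-- Substituting t = 1 - 2x turns t² - 1 into -4x(1-x), so Rodrigues' formula becomes the shifted
-- one. The explicit coefficients of the shifted polynomial then give the expansion of P_m at the
-- north pole.
open Polynomial in
theorem legendreP_comp (m : ℕ) : (legendreP m).comp (1 - C 2 * X) = realShiftedLegendre m := by
  have h2 : (((X : ℝ[X]) ^ 2 - 1) ^ m).comp (1 - C 2 * X)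
      = C ((-4) ^ m) * (X ^ m * (1 - X) ^ m) := by
    simp only [pow_comp, sub_comp, X_comp, one_comp, C_pow, ← mul_pow]
    congr 1
    simp only [C_neg, map_ofNat]
    ring
  have h3 := iterate_derivative_comp_one_sub_two_mul_X ((X ^ 2 - 1) ^ m) m
  have h4 := congrArg (Polynomial.map (Int.castRingHom ℝ))
    (Polynomial.factorial_mul_shiftedLegendre_eq m)
  rw [← iterate_derivative_map] at h4
  simp only [Polynomial.map_mul, Polynomial.map_natCast, Polynomial.map_pow, Polynomial.map_X,
    Polynomial.map_sub, Polynomial.map_one] at h4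
  rw [h2, iterate_derivative_C_mul, ← h4] at h3
  have hf : (m.factorial : ℝ) ≠ 0 := by positivity
  have h5 : (derivative^[m] ((X ^ 2 - 1) ^ m : ℝ[X])).comp (1 - C 2 * X) =
      C (2 ^ m * (m.factorial : ℝ)) * realShiftedLegendre m := by
    have hc : (C ((-2 : ℝ) ^ m)) ≠ 0 := by simp
    apply mul_left_cancel₀ hc
    rw [← h3, realShiftedLegendre, show (-4 : ℝ) = (-2) * 2 by norm_num, mul_pow]
    simp only [C_mul, map_natCast]
    ring
  rw [legendreP, mul_comp, C_comp, h5, ← mul_assoc, ← C_mul, one_div_mul_cancel (by positivity)]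
  simp

theorem legendreP_eval (m : ℕ) (t : ℝ) :
    (legendreP m).eval t = (realShiftedLegendre m).eval ((1 - t) / 2) := by
  rw [← legendreP_comp, Polynomial.eval_comp]
  congr 1
  simp
  ring

/-- This hypergeometric recursion serves twice: it is the differential equation read
coefficientwise, and after rescaling it exhibits the Bessel limit. -/
theorem realShiftedLegendre_coeff_succ (m k : ℕ) :
    (realShiftedLegendre m).coeff (k + 1) * ((k : ℝ) + 1) ^ 2 =
      ((k : ℝ) * (k + 1) - m * (m + 1)) * (realShiftedLegendre m).coeff k := by
  rw [realShiftedLegendre_coeff, realShiftedLegendre_coeff]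
  have h1 : (m.choose (k + 1) : ℝ) * (k + 1) = m.choose k * (m - k) := by
    rcases le_or_gt k m with h | h
    · rw [← Nat.cast_sub h]
      exact_mod_cast Nat.choose_succ_right_eq m k
    · rw [Nat.choose_eq_zero_of_lt h, Nat.choose_eq_zero_of_lt (by omega)]
      simp
  have h2 : ((m + (k + 1)).choose m : ℝ) * (k + 1) = (m + k).choose m * (m + k + 1) := by
    have := Nat.choose_mul_succ_eq (m + k) m
    rw [show m + k + 1 - m = k + 1 by omega] at this
    have h : ((m + k).choose m : ℝ) * ((m + k : ℕ) + 1) = (m + k + 1).choose m * ((k : ℝ) + 1) := by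
      exact_mod_cast this
    push_cast at h
    rw [← add_assoc]
    linarith
  calc _ = (-1) ^ (k + 1) * ((m.choose (k + 1) : ℝ) * (k + 1)) *
        (((m + (k + 1)).choose m : ℝ) * (k + 1)) := by ring
    _ = _ := by
      rw [h1, h2]
      ring

open Polynomial in
theorem realShiftedLegendre_ode (m : ℕ) :
    X * (1 - X) * derivative (derivative (realShiftedLegendre m)) +
      (1 - C 2 * X) * derivative (realShiftedLegendre m) +
      C ((m : ℝ) * (m + 1)) * realShiftedLegendre m = 0 := by
  ext k
  have h := realShiftedLegendre_coeff_succ m k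
  have e : X * (1 - X) * derivative (derivative (realShiftedLegendre m)) +
      (1 - C 2 * X) * derivative (realShiftedLegendre m) +
      C ((m : ℝ) * (m + 1)) * realShiftedLegendre m =
      X * derivative (derivative (realShiftedLegendre m)) -
      X ^ 2 * derivative (derivative (realShiftedLegendre m)) +
      derivative (realShiftedLegendre m) - C 2 * (X * derivative (realShiftedLegendre m)) +
      C ((m : ℝ) * (m + 1)) * realShiftedLegendre m := by ring
  rw [e]
  generalize (m : ℝ) * (m + 1) = c at h ⊢
  rcases k with _ | _ | k
  · simp [coeff_derivative] at h ⊢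
    linarith
  · simp [coeff_X_pow_mul', coeff_derivative, coeff_X_mul] at h ⊢
    linarith
  · simp [coeff_X_pow_mul', coeff_derivative, coeff_X_mul] at h ⊢
    linarith

theorem realShiftedLegendre_eval_ode (m : ℕ) (x : ℝ) :
    x * (1 - x) * (realShiftedLegendre m).derivative.derivative.eval x +
      (1 - 2 * x) * (realShiftedLegendre m).derivative.eval x +
      (m : ℝ) * (m + 1) * (realShiftedLegendre m).eval x = 0 := by
  have h := congrArg (Polynomial.eval x) (realShiftedLegendre_ode m)
  simpa using h

theorem legendreP_eval_ode (m : ℕ) (t : ℝ) :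
    (1 - t ^ 2) * (legendreP m).derivative.derivative.eval t -
      2 * t * (legendreP m).derivative.eval t +
      (m : ℝ) * (m + 1) * (legendreP m).eval t = 0 := by
  have h := realShiftedLegendre_eval_ode m ((1 - t) / 2)
  rw [← legendreP_comp] at h
  simp only [Polynomial.derivative_comp, Polynomial.derivative_mul, Polynomial.derivative_sub,
    Polynomial.derivative_one, Polynomial.derivative_C, Polynomial.derivative_X, Polynomial.eval_mul,
    Polynomial.eval_comp, Polynomial.eval_sub, Polynomial.eval_one, Polynomial.eval_C,
    Polynomial.eval_X, zero_mul, mul_one, zero_add, zero_sub, Polynomial.derivative_neg, Polynomial.eval_neg, neg_zero] at h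
  rw [show 1 - 2 * ((1 - t) / 2) = t by ring] at h
  linear_combination h

theorem realShiftedLegendre_eval_zero (m : ℕ) : (realShiftedLegendre m).eval 0 = 1 := by
  rw [← Polynomial.coeff_zero_eq_eval_zero, realShiftedLegendre_coeff]
  simp

/-! ### The spherical Laplacian of zonal harmonics -/

/-- Reduces a diagonal second derivative to one-variable calculus along the line x + t v. -/
theorem iteratedFDeriv_two_apply_self_eq {E : Type*} [NormedAddCommGroup E] [NormedSpace ℝ E]
    {f : E → ℝ} {x v : E} {h' : ℝ → ℝ} {c : ℝ} (hf : ContDiffAt ℝ 2 f x)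
    (h1 : ∀ᶠ s in 𝓝 (0 : ℝ), HasDerivAt (fun t => f (x + t • v)) (h' s) s)
    (h2 : HasDerivAt h' c 0) : iteratedFDeriv ℝ 2 f x ![v, v] = c := by
  rw [iteratedFDeriv_two_apply]
  have hline : ∀ s : ℝ, HasDerivAt (fun t : ℝ => x + t • v) v s := fun s => by
    simpa using ((hasDerivAt_id s).smul_const v).const_add x
  have hcont : Tendsto (fun t : ℝ => x + t • v) (𝓝 0) (𝓝 x) := by
    simpa using (hline 0).continuousAt.tendsto
  have hd : ∀ᶠ y in 𝓝 x, DifferentiableAt ℝ f y := by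
    filter_upwards [hf.eventually (by simp)] with y hy using hy.differentiableAt (by simp)
  have hev : h' =ᶠ[𝓝 0] fun s => fderiv ℝ f (x + s • v) v := by
    filter_upwards [h1, hcont.eventually hd] with s hs1 hs2
    exact hs1.unique (hs2.hasFDerivAt.comp_hasDerivAt s (hline s))
  have hff : DifferentiableAt ℝ (fderiv ℝ f) x :=
    (hf.fderiv_right (m := 1) (by norm_num)).differentiableAt (by simp)
  have hfx : HasFDerivAt (fderiv ℝ f) (fderiv ℝ (fderiv ℝ f) x) (x + (0 : ℝ) • v) := by
    simpa using hff.hasFDerivAt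
  have h3 : HasDerivAt (fun s : ℝ => fderiv ℝ f (x + s • v) v)
      (fderiv ℝ (fderiv ℝ f) x v v) 0 :=
    (ContinuousLinearMap.apply ℝ ℝ v).hasFDerivAt.comp_hasDerivAt (0 : ℝ)
      (hfx.comp_hasDerivAt (0 : ℝ) (hline 0))
  exact h3.unique (h2.congr_of_eventuallyEq hev.symm)

theorem norm_add_smul_single_sq (x : EuclideanSpace ℝ (Fin 3)) (hx : ‖x‖ = 1) (i : Fin 3) (s : ℝ) :
    ‖x + s • EuclideanSpace.basisFun (Fin 3) ℝ i‖ = √(1 + 2 * x i * s + s ^ 2) := by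
  rw [EuclideanSpace.norm_eq] at hx ⊢
  rw [Real.sqrt_eq_one] at hx
  congr 1
  simp only [Fin.sum_univ_three, Real.norm_eq_abs, sq_abs] at hx ⊢
  fin_cases i <;> simp <;> linarith

theorem contDiffAt_polynomial_coord_div_norm (P : Polynomial ℝ) (x : EuclideanSpace ℝ (Fin 3))
    (hx : x ≠ 0) : ContDiffAt ℝ 2 (fun y => P.eval (y 2 / ‖y‖)) x := by
  have h1 : ContDiffAt ℝ 2 (fun y : EuclideanSpace ℝ (Fin 3) => y 2 / ‖y‖) x := by
    refine ContDiffAt.div ?_ (contDiffAt_norm ℝ hx) (by simpa using hx)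
    exact (EuclideanSpace.proj (𝕜 := ℝ) (2 : Fin 3)).contDiff.contDiffAt
  have h2 : ContDiff ℝ 2 (fun t => P.eval t) := by
    simpa using P.contDiff_aeval (𝕜 := ℝ) 2
  exact h2.contDiffAt.comp x h1

/-- On the line x + s e_i the norm is √(1 + 2 x_i s + s²), so the function is P((z + sδ)/R(s)) with
z = x₂ and can be differentiated twice at s = 0. Keeping δ symbolic treats the three directions
together. -/
theorem iteratedFDeriv_polynomial_coord_div_norm (P : Polynomial ℝ)
    (x : EuclideanSpace ℝ (Fin 3)) (hx : ‖x‖ = 1) (i : Fin 3) (δ : ℝ)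
    (hδ : (EuclideanSpace.basisFun (Fin 3) ℝ i) 2 = δ) :
    iteratedFDeriv ℝ 2 (fun y : EuclideanSpace ℝ (Fin 3) => P.eval (y 2 / ‖y‖)) x
      ![EuclideanSpace.basisFun (Fin 3) ℝ i, EuclideanSpace.basisFun (Fin 3) ℝ i] =
    P.derivative.derivative.eval (x 2) * (δ - x 2 * x i) ^ 2 +
      P.derivative.eval (x 2) * (x 2 * (3 * x i ^ 2 - 1) - 2 * δ * x i) := by
  have hx0 : x ≠ 0 := by
    rintro rfl
    simp at hx
  set c := x i
  set R : ℝ → ℝ := fun s => √(1 + 2 * c * s + s ^ 2) with hR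
  have hR0 : R 0 = 1 := by simp [hR]
  have hRd : ∀ s, 0 < 1 + 2 * c * s + s ^ 2 → HasDerivAt R ((c + s) / R s) s := by
    intro s hs
    have h1 : HasDerivAt (fun s : ℝ => 1 + 2 * c * s + s ^ 2) (2 * c + 2 * s) s := by
      simpa using (((hasDerivAt_id' s).const_mul (2 * c)).const_add 1).fun_add
        ((hasDerivAt_id' s).fun_pow 2)
    convert h1.sqrt hs.ne' using 1
    simp only [hR]
    field_simp
  have hpos : ∀ᶠ s in 𝓝 (0 : ℝ), 0 < 1 + 2 * c * s + s ^ 2 := by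
    have : ContinuousAt (fun s : ℝ => 1 + 2 * c * s + s ^ 2) 0 := by fun_prop
    exact this.eventually (lt_mem_nhds (by norm_num))
  have hg : ∀ s, 0 < 1 + 2 * c * s + s ^ 2 →
      HasDerivAt (fun s => (x 2 + s * δ) / R s) (δ / R s - (x 2 + s * δ) * (c + s) / R s ^ 3) s := by
    intro s hs
    have hRs : 0 < R s := Real.sqrt_pos.mpr hs
    have h1 : HasDerivAt (fun s : ℝ => x 2 + s * δ) δ s := by
      simpa using ((hasDerivAt_id s).mul_const δ).const_add (x 2)
    refine (h1.fun_div (hRd s hs) hRs.ne').congr_deriv ?_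
    field_simp
  have hform : (fun t : ℝ => P.eval ((x + t • EuclideanSpace.basisFun (Fin 3) ℝ i) 2 /
      ‖x + t • EuclideanSpace.basisFun (Fin 3) ℝ i‖)) =
      fun t => P.eval ((x 2 + t * δ) / R t) := by
    funext t
    rw [norm_add_smul_single_sq x hx, PiLp.add_apply, PiLp.smul_apply, hδ, smul_eq_mul]
  refine iteratedFDeriv_two_apply_self_eq (h' := fun s => P.derivative.eval ((x 2 + s * δ) / R s) *
      (δ / R s - (x 2 + s * δ) * (c + s) / R s ^ 3))
    (contDiffAt_polynomial_coord_div_norm P x hx0) ?_ ?_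
  · filter_upwards [hpos] with s hs
    rw [hform]
    exact (P.hasDerivAt _).comp s (hg s hs)
  · have hp0 : 0 < 1 + 2 * c * 0 + (0 : ℝ) ^ 2 := by norm_num
    have hR' : HasDerivAt R c 0 := by simpa [hR0] using hRd 0 hp0
    have h1 : HasDerivAt (fun s => P.derivative.eval ((x 2 + s * δ) / R s))
        (P.derivative.derivative.eval (x 2) * (δ - x 2 * c)) 0 := by
      have h := (P.derivative.hasDerivAt ((x 2 + 0 * δ) / R 0)).comp 0 (hg 0 hp0)
      simpa [hR0, Function.comp_def] using h
    have hA : HasDerivAt (fun s : ℝ => x 2 + s * δ) δ 0 := by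
      simpa using ((hasDerivAt_id (0 : ℝ)).mul_const δ).const_add (x 2)
    have hB : HasDerivAt (fun s : ℝ => c + s) 1 0 := by
      simpa using (hasDerivAt_id (0 : ℝ)).const_add c
    have h2 := ((hasDerivAt_const (0 : ℝ) δ).fun_div hR' (by simp [hR0])).fun_sub
      ((hA.fun_mul hB).fun_div (hR'.fun_pow 3) (by simp [hR0]))
    refine (h1.fun_mul h2).congr_deriv ?_
    simp only [hR0]
    norm_num
    ring

theorem radialExtension_zonalHarmonic (m : ℕ) {y : EuclideanSpace ℝ (Fin 3)} (hy : y ≠ 0) :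
    radialExtension (zonalHarmonic m) y = (legendreP m).eval (y 2 / ‖y‖) := by
  rw [radialExtension, dif_neg hy, zonalHarmonic]
  simp [div_eq_inv_mul]

theorem sphereLaplacian_zonalHarmonic (m : ℕ) (x : S2) :
    -sphereLaplacian (zonalHarmonic m) x = (m : ℝ) * (m + 1) * zonalHarmonic m x := by
  have hx : ‖(x : EuclideanSpace ℝ (Fin 3))‖ = 1 := norm_eq_of_mem_sphere x
  have hx0 : (x : EuclideanSpace ℝ (Fin 3)) ≠ 0 := by
    intro h
    simp [h] at hx
  have hev : radialExtension (zonalHarmonic m) =ᶠ[𝓝 (x : EuclideanSpace ℝ (Fin 3))]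
      fun y => (legendreP m).eval (y 2 / ‖y‖) := by
    filter_upwards [isOpen_ne.mem_nhds hx0] with y hy using radialExtension_zonalHarmonic m hy
  have hsum : (x : EuclideanSpace ℝ (Fin 3)) 0 ^ 2 + (x : EuclideanSpace ℝ (Fin 3)) 1 ^ 2 +
      (x : EuclideanSpace ℝ (Fin 3)) 2 ^ 2 = 1 := by
    have h := hx
    rw [EuclideanSpace.norm_eq, Real.sqrt_eq_one] at h
    simpa [Fin.sum_univ_three] using h
  rw [sphereLaplacian, (InnerProductSpace.laplacian_congr_nhds hev).eq_of_nhds,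
    InnerProductSpace.laplacian_eq_iteratedFDeriv_orthonormalBasis _
      (EuclideanSpace.basisFun (Fin 3) ℝ)]
  beta_reduce
  rw [Fin.sum_univ_three,
    iteratedFDeriv_polynomial_coord_div_norm _ _ hx 0 0 (by simp),
    iteratedFDeriv_polynomial_coord_div_norm _ _ hx 1 0 (by simp),
    iteratedFDeriv_polynomial_coord_div_norm _ _ hx 2 1 (by simp), zonalHarmonic]
  have hode := legendreP_eval_ode m ((x : EuclideanSpace ℝ (Fin 3)) 2)
  set P'' := (legendreP m).derivative.derivative.eval ((x : EuclideanSpace ℝ (Fin 3)) 2)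
  set P' := (legendreP m).derivative.eval ((x : EuclideanSpace ℝ (Fin 3)) 2)
  set z := (x : EuclideanSpace ℝ (Fin 3)) 2
  -- With |x| = 1 the three second derivatives add up to (1 - z²)P'' - 2zP', the Legendre operator.
  linear_combination -hode - (P'' * z ^ 2 + 3 * P' * z) * hsum

theorem legendreP_eval_one (m : ℕ) : (legendreP m).eval 1 = 1 := by
  rw [legendreP_eval]
  simp [realShiftedLegendre_eval_zero]

theorem exists_sphere_coord_eq {t : ℝ} (h : t ∈ Set.Icc (-1 : ℝ) 1) :
    ∃ x : S2, (x : EuclideanSpace ℝ (Fin 3)) 2 = t := by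
  refine ⟨⟨!₂[√(1 - t ^ 2), 0, t], ?_⟩, by simp⟩
  have : 0 ≤ 1 - t ^ 2 := by nlinarith [h.1, h.2]
  simp [EuclideanSpace.norm_eq, Fin.sum_univ_three, Real.sq_sqrt this]

theorem contMDiff_zonalHarmonic (m : ℕ) : ContMDiff (𝓡 2) 𝓘(ℝ, ℝ) ∞ (zonalHarmonic m) := by
  have h1 : ContDiff ℝ ∞ (fun y : EuclideanSpace ℝ (Fin 3) => (legendreP m).eval (y 2)) := by
    have h2 : ContDiff ℝ ∞ (fun t => (legendreP m).eval t) := by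
      simpa using (legendreP m).contDiff_aeval (𝕜 := ℝ) ∞
    exact h2.comp (EuclideanSpace.proj (𝕜 := ℝ) (2 : Fin 3)).contDiff
  have : Fact (Module.finrank ℝ (EuclideanSpace ℝ (Fin 3)) = 2 + 1) := ⟨by simp⟩
  exact h1.contMDiff.comp (contMDiff_coe_sphere (n := 2))

theorem isLaplaceEigenfunction_zonalHarmonic (m : ℕ) :
    IsLaplaceEigenfunction (zonalHarmonic m) ((m : ℝ) * (m + 1)) where
  smooth := contMDiff_zonalHarmonic m
  ne_zero h := by
    obtain ⟨x, hx⟩ := exists_sphere_coord_eq (t := 1) (by simp)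
    have := congrFun h x
    simp [zonalHarmonic, hx, legendreP_eval_one] at this
  eigen := sphereLaplacian_zonalHarmonic m

/-! ### Archimedes' hat-box theorem -/

theorem lintegral_sq_eq_lintegral_Ioi (g : ℝ → ℝ≥0∞) :
    ∫⁻ u in Set.Ioi (0 : ℝ), g u =
      ∫⁻ r in Set.Ioi (0 : ℝ), ENNReal.ofReal (2 * r) * g (r ^ 2) := by
  have himg : (fun r : ℝ => r ^ 2) '' Set.Ioi 0 = Set.Ioi 0 := by
    ext u
    constructor
    · rintro ⟨r, hr, rfl⟩
      exact pow_pos (Set.mem_Ioi.mp hr) 2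
    · intro hu
      exact ⟨√u, Real.sqrt_pos.mpr hu, Real.sq_sqrt (le_of_lt hu)⟩
  have hinj : Set.InjOn (fun r : ℝ => r ^ 2) (Set.Ioi 0) := fun a ha b hb h =>
    (pow_left_inj₀ (le_of_lt ha) (le_of_lt hb) two_ne_zero).mp h
  have h := lintegral_image_eq_lintegral_abs_deriv_mul (f := fun r : ℝ => r ^ 2)
    (f' := fun r => 2 * r) measurableSet_Ioi
    (fun r _ => by simpa using (hasDerivAt_pow 2 r).hasDerivWithinAt) hinj g
  rw [himg] at h
  rw [h]
  refine setLIntegral_congr_fun measurableSet_Ioi fun r hr => ?_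
  have : 0 < r := hr
  rw [abs_of_pos (by positivity)]

theorem lintegral_add_sq (g : ℝ → ℝ≥0∞) (hg : Measurable g) :
    ∫⁻ w : ℝ × ℝ, g (w.1 ^ 2 + w.2 ^ 2) =
      ENNReal.ofReal Real.pi * ∫⁻ u in Set.Ioi (0 : ℝ), g u := by
  rw [← lintegral_comp_polarCoord_symm, lintegral_sq_eq_lintegral_Ioi]
  have h1 : ∀ p : ℝ × ℝ, ENNReal.ofReal p.1 •
      g ((polarCoord.symm p).1 ^ 2 + (polarCoord.symm p).2 ^ 2) =
      ENNReal.ofReal p.1 * g (p.1 ^ 2) := by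
    intro p
    simp only [polarCoord_symm_apply, smul_eq_mul]
    congr 2
    linear_combination p.1 ^ 2 * Real.cos_sq_add_sin_sq p.2
  simp only [h1]
  rw [polarCoord_target, Measure.volume_eq_prod, ← Measure.prod_restrict,
    lintegral_prod _ (by fun_prop)]
  simp only [lintegral_const, Measure.restrict_apply_univ, Real.volume_Ioo, sub_neg_eq_add]
  rw [← lintegral_const_mul _ (by fun_prop)]
  refine lintegral_congr fun r => ?_
  rw [← two_mul, ENNReal.ofReal_mul zero_le_two, ENNReal.ofReal_mul zero_le_two]
  ring

theorem lintegral_euclideanSpace_three (H : ℝ × ℝ × ℝ → ℝ≥0∞) (hH : Measurable H) :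
    ∫⁻ y : EuclideanSpace ℝ (Fin 3), H (y 2, y 0, y 1) =
      ∫⁻ z : ℝ, ∫⁻ w : ℝ × ℝ, H (z, w) := by
  have h1 := (EuclideanSpace.volume_preserving_symm_measurableEquiv_toLp (Fin 3))
  have h2 := volume_preserving_piFinSuccAbove (fun _ : Fin 3 => ℝ) 2
  have h3 := (MeasurePreserving.id (volume : Measure ℝ)).prod (volume_preserving_finTwoArrow ℝ)
  have h4 := h3.comp (h2.comp h1)
  rw [← lintegral_prod _ hH.aemeasurable, ← Measure.volume_eq_prod]
  have h5 := h4.lintegral_comp hH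
  rw [← Measure.volume_eq_prod] at h5
  rw [← h5]
  rfl

-- `Measure.toSphere` measures a set by the volume of the cone over it. The cone is written through
-- ‖y‖², the variable of integration below.
open scoped Pointwise in
theorem Ioo_smul_sphere_coord (B : Set ℝ) :
    Set.Ioo (0 : ℝ) 1 • ((↑) '' {x : S2 | (x : EuclideanSpace ℝ (Fin 3)) 2 ∈ B} :
      Set (EuclideanSpace ℝ (Fin 3))) =
      {y | 0 < ‖y‖ ^ 2 ∧ ‖y‖ ^ 2 < 1 ∧ y 2 * (√(‖y‖ ^ 2))⁻¹ ∈ B} := by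
  ext y
  simp only [Set.mem_smul, Set.mem_image, Set.mem_ofPred_eq, Real.sqrt_sq (norm_nonneg y)]
  constructor
  · rintro ⟨r, hr, _, ⟨x, hx, rfl⟩, rfl⟩
    have hn : ‖r • (x : EuclideanSpace ℝ (Fin 3))‖ = r := by
      rw [norm_smul, norm_eq_of_mem_sphere, mul_one, Real.norm_of_nonneg hr.1.le]
    rw [hn]
    refine ⟨pow_pos hr.1 2, pow_lt_one₀ hr.1.le hr.2 two_ne_zero, ?_⟩
    have : r ≠ 0 := hr.1.ne'
    have e : (r • (x : EuclideanSpace ℝ (Fin 3))) 2 * r⁻¹ =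
        (x : EuclideanSpace ℝ (Fin 3)) 2 := by
      simp only [PiLp.smul_apply, smul_eq_mul]
      field_simp
    rwa [e]
  · rintro ⟨h0, h1, h2⟩
    have hy : 0 < ‖y‖ := by
      rcases (norm_nonneg y).eq_or_lt with h | h
      · simp [← h] at h0
      · exact h
    refine ⟨‖y‖, ⟨hy, by nlinarith⟩, ‖y‖⁻¹ • y,
      ⟨⟨‖y‖⁻¹ • y, by simp [norm_smul, hy.ne']⟩, ?_, rfl⟩, ?_⟩
    · simpa [mul_comm] using h2
    · rw [smul_smul, mul_inv_cancel₀ hy.ne', one_smul]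

/-- In the variables z = y₂ and v = ‖y‖², volume has constant density π on z² < v. The slice at
fixed v is B ∩ (-1,1) scaled by √v, so the integral factors. -/
theorem volume_truncated_cone (B : Set ℝ) (hB : MeasurableSet B) :
    volume {y : EuclideanSpace ℝ (Fin 3) |
      0 < ‖y‖ ^ 2 ∧ ‖y‖ ^ 2 < 1 ∧ y 2 * (√(‖y‖ ^ 2))⁻¹ ∈ B} =
    ENNReal.ofReal Real.pi * (∫⁻ v in Set.Ioo (0 : ℝ) 1, ENNReal.ofReal √v) *
      volume (B ∩ Set.Ioo (-1) 1) := by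
  set T : Set (ℝ × ℝ) := {q | 0 < q.2 ∧ q.2 < 1 ∧ q.1 * (√q.2)⁻¹ ∈ B} with hTdef
  have hT : MeasurableSet T := by
    refine (measurableSet_lt measurable_const measurable_snd).inter
      ((measurableSet_lt measurable_snd measurable_const).inter ?_)
    exact (show Measurable fun q : ℝ × ℝ => q.1 * (√q.2)⁻¹ by fun_prop) hB
  set G : ℝ × ℝ → ℝ≥0∞ := T.indicator 1 with hG
  have hGm : Measurable G := measurable_one.indicator hT
  set D : Set (ℝ × ℝ) := {q | q.1 ^ 2 < q.2} with hD
  have hDm : MeasurableSet D :=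
    measurableSet_lt (by fun_prop : Measurable fun q : ℝ × ℝ => q.1 ^ 2) measurable_snd
  have hnorm : ∀ y : EuclideanSpace ℝ (Fin 3), ‖y‖ ^ 2 = y 2 ^ 2 + (y 0 ^ 2 + y 1 ^ 2) := by
    intro y
    rw [EuclideanSpace.norm_sq_eq]
    simp only [Fin.sum_univ_three, Real.norm_eq_abs, sq_abs]
    ring
  have hset : {y : EuclideanSpace ℝ (Fin 3) |
      0 < ‖y‖ ^ 2 ∧ ‖y‖ ^ 2 < 1 ∧ y 2 * (√(‖y‖ ^ 2))⁻¹ ∈ B} =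
      (fun y : EuclideanSpace ℝ (Fin 3) => (y 2, y 2 ^ 2 + (y 0 ^ 2 + y 1 ^ 2))) ⁻¹' T := by
    ext y
    simp [hTdef, hnorm]
  have hmeas : Measurable
      (fun y : EuclideanSpace ℝ (Fin 3) => (y 2, y 2 ^ 2 + (y 0 ^ 2 + y 1 ^ 2))) := by fun_prop
  rw [hset, ← lintegral_indicator_one (hmeas hT)]
  have hcomp : ∀ y : EuclideanSpace ℝ (Fin 3),
      ((fun y : EuclideanSpace ℝ (Fin 3) => (y 2, y 2 ^ 2 + (y 0 ^ 2 + y 1 ^ 2))) ⁻¹' T).indicator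
        (1 : EuclideanSpace ℝ (Fin 3) → ℝ≥0∞) y =
      (fun q : ℝ × ℝ × ℝ => G (q.1, q.1 ^ 2 + (q.2.1 ^ 2 + q.2.2 ^ 2))) (y 2, y 0, y 1) :=
    fun y => rfl
  simp only [hcomp]
  rw [lintegral_euclideanSpace_three
    (fun q : ℝ × ℝ × ℝ => G (q.1, q.1 ^ 2 + (q.2.1 ^ 2 + q.2.2 ^ 2))) (hGm.comp (by fun_prop))]
  have h1 : ∀ z : ℝ, ∫⁻ w : ℝ × ℝ, G (z, z ^ 2 + (w.1 ^ 2 + w.2 ^ 2)) =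
      ENNReal.ofReal Real.pi * ∫⁻ v : ℝ, D.indicator G (z, v) := by
    intro z
    -- Translation by z² replaces u = y₀² + y₁² by v; the set `D` keeps the condition u > 0.
    rw [lintegral_add_sq (fun u => G (z, z ^ 2 + u)) (hGm.comp (by fun_prop)),
      ← lintegral_add_left_eq_self (fun v => D.indicator G (z, v)) (z ^ 2), ← lintegral_indicator measurableSet_Ioi]
    congr 1
    refine lintegral_congr fun u => ?_
    simp [Set.indicator, hD]
  have hDG : Measurable (D.indicator G) := hGm.indicator hDm
  simp only [h1]
  rw [lintegral_const_mul _ hDG.lintegral_prod_right', mul_assoc,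
    lintegral_lintegral_swap (f := fun z v => D.indicator G (z, v)) hDG.aemeasurable]
  congr 1
  rw [← lintegral_mul_const _ (by fun_prop), ← lintegral_indicator measurableSet_Ioo]
  refine lintegral_congr fun v => ?_
  by_cases hv : v ∈ Set.Ioo (0 : ℝ) 1
  · have hs : 0 < √v := Real.sqrt_pos.mpr hv.1
    rw [Set.indicator_of_mem hv]
    have h2 : ∀ z, D.indicator G (z, v) =
        ((fun z => z * (√v)⁻¹) ⁻¹' (B ∩ Set.Ioo (-1) 1)).indicator 1 z := by
      intro z
      have e : z ^ 2 < v ↔ z * (√v)⁻¹ ∈ Set.Ioo (-1 : ℝ) 1 := by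
        rw [← div_eq_mul_inv, Set.mem_Ioo, lt_div_iff₀ hs, div_lt_iff₀ hs, neg_one_mul, one_mul,
          ← abs_lt, ← Real.sqrt_sq_eq_abs, Real.sqrt_lt_sqrt_iff (sq_nonneg z)]
      have e' : z ∈ (fun z => z * (√v)⁻¹) ⁻¹' (B ∩ Set.Ioo (-1) 1) ↔
          z * (√v)⁻¹ ∈ B ∧ z ^ 2 < v := by
        rw [e]
        rfl
      simp only [Set.indicator, hD, hG, hTdef, Set.mem_ofPred_eq, e', Pi.one_apply]
      have hv0 := hv.1
      have hv1 := hv.2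
      split_ifs <;> tauto
    simp only [h2]
    rw [lintegral_indicator_one
      ((show Measurable fun z : ℝ => z * (√v)⁻¹ by fun_prop) (hB.inter measurableSet_Ioo)),
      Real.volume_preimage_mul_right (inv_ne_zero hs.ne'), inv_inv, abs_of_pos hs]
  · rw [Set.indicator_of_notMem hv]
    have h2 : ∀ z, D.indicator G (z, v) = 0 := by
      intro z
      simp only [Set.indicator, hG, hTdef, Set.mem_ofPred_eq, Pi.one_apply]
      split_ifs with h3 h4
      · exact absurd ⟨h4.1, h4.2.1⟩ hv
      all_goals rfl
    simp [h2]

instance : IsFiniteMeasure surfaceMeasure := by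
  unfold surfaceMeasure
  infer_instance

instance : surfaceMeasure.IsOpenPosMeasure := by
  unfold surfaceMeasure
  infer_instance

/-- Archimedes' hat-box theorem, up to the value of the constant. -/
theorem exists_map_coord_surfaceMeasure :
    ∃ c : ℝ≥0∞, c ≠ 0 ∧ c ≠ ⊤ ∧
      surfaceMeasure.map (fun x : S2 => (x : EuclideanSpace ℝ (Fin 3)) 2) =
        c • volume.restrict (Set.Ioo (-1 : ℝ) 1) := by
  have hm : Measurable (fun x : S2 => (x : EuclideanSpace ℝ (Fin 3)) 2) := by fun_prop
  set c : ℝ≥0∞ := 3 * (ENNReal.ofReal Real.pi * (∫⁻ v in Set.Ioo (0 : ℝ) 1, ENNReal.ofReal √v))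
  have hmap : surfaceMeasure.map (fun x : S2 => (x : EuclideanSpace ℝ (Fin 3)) 2) =
      c • volume.restrict (Set.Ioo (-1 : ℝ) 1) := by
    ext B hB
    rw [Measure.map_apply hm hB, surfaceMeasure, Measure.toSphere_apply' _ (hm hB)]
    have h := Ioo_smul_sphere_coord B
    rw [Set.preimage]
    rw [h, volume_truncated_cone B hB]
    simp [c, Measure.restrict_apply hB, mul_assoc]
  -- The total mass of the sphere is positive and finite, which forces the same of `c` without
  -- evaluating it.
  have huniv := congrArg (fun μ => μ Set.univ) hmap
  simp only [Measure.map_apply hm MeasurableSet.univ, Set.preimage_univ, Measure.smul_apply,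
    Measure.restrict_apply_univ, Real.volume_Ioo, smul_eq_mul] at huniv
  have hne : surfaceMeasure Set.univ ≠ 0 := by
    obtain ⟨x, -⟩ := exists_sphere_coord_eq (t := 1) (by simp)
    exact isOpen_univ.measure_ne_zero _ ⟨x, trivial⟩
  refine ⟨c, ?_, ?_, hmap⟩
  · intro h0
    rw [h0, zero_mul] at huniv
    exact hne huniv
  · intro h0
    rw [h0, ENNReal.top_mul (by norm_num)] at huniv
    exact measure_ne_top _ _ huniv

/-! ### Rescaling at the pole and the Bessel limit -/

/-- The Taylor coefficients of `y ↦ J₀(2√y)`. -/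
noncomputable def besselCoeff (k : ℕ) : ℝ := (-1) ^ k * (1 / (k.factorial : ℝ) ^ 2)

/-- The entire function `y ↦ J₀(2√y)`. -/
noncomputable def besselSeries (y : ℝ) : ℝ := ∑' k, besselCoeff k * y ^ k

/-- The Taylor coefficients of `rescaledLegendre`. -/
noncomputable def rescaledCoeff (m k : ℕ) : ℝ :=
  (realShiftedLegendre m).coeff k / ((m : ℝ) * (m + 1)) ^ k

/-- The Legendre polynomial `P_m` near `1`, on the scale of its oscillations. -/
noncomputable def rescaledLegendre (m : ℕ) (y : ℝ) : ℝ :=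
  (realShiftedLegendre m).eval (y / ((m : ℝ) * (m + 1)))

theorem besselCoeff_succ (k : ℕ) :
    besselCoeff (k + 1) = -1 / ((k : ℝ) + 1) ^ 2 * besselCoeff k := by
  simp only [besselCoeff, Nat.factorial_succ]
  push_cast
  field_simp
  ring

theorem rescaledCoeff_zero (m : ℕ) : rescaledCoeff m 0 = 1 := by
  simp [rescaledCoeff, realShiftedLegendre_coeff]

theorem rescaledCoeff_succ {m : ℕ} (hm : 0 < m) (k : ℕ) :
    rescaledCoeff m (k + 1) =
      ((k : ℝ) * (k + 1) / (m * (m + 1)) - 1) / ((k : ℝ) + 1) ^ 2 * rescaledCoeff m k := by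
  have h := realShiftedLegendre_coeff_succ m k
  have hm' : (0 : ℝ) < m := by exact_mod_cast hm
  rw [← eq_div_iff (by positivity)] at h
  rw [rescaledCoeff, rescaledCoeff, h]
  field_simp
  ring

theorem rescaledCoeff_eq_zero {m k : ℕ} (h : m < k) : rescaledCoeff m k = 0 := by
  simp [rescaledCoeff, realShiftedLegendre_coeff, Nat.choose_eq_zero_of_lt h]

theorem abs_besselCoeff (k : ℕ) : |besselCoeff k| = 1 / (k.factorial : ℝ) ^ 2 := by
  simp [besselCoeff, abs_mul]

/-- While k < m the factor k(k+1)/N - 1 in the recursion lies in [-1, 0]; beyond the degree the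
coefficients vanish. -/
theorem abs_rescaledCoeff_le {m : ℕ} (hm : 0 < m) (k : ℕ) :
    |rescaledCoeff m k| ≤ 1 / (k.factorial : ℝ) ^ 2 := by
  induction k with
  | zero => simp [rescaledCoeff_zero]
  | succ k ih =>
    rcases lt_or_ge m (k + 1) with h | h
    · rw [rescaledCoeff_eq_zero h]
      simp
    · have hm' : (0 : ℝ) < m := by exact_mod_cast hm
      have hk : (k : ℝ) ≤ m := by exact_mod_cast (by omega : k ≤ m)
      have h1 : (k : ℝ) * (k + 1) / (m * (m + 1)) ≤ 1 := by
        rw [div_le_one (by positivity)]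
        gcongr
      have h2 : 0 ≤ (k : ℝ) * (k + 1) / (m * (m + 1)) := by positivity
      have h3 : |((k : ℝ) * (k + 1) / (m * (m + 1)) - 1)| ≤ 1 := by
        rw [abs_le]
        constructor <;> linarith
      rw [rescaledCoeff_succ hm, abs_mul, abs_div, abs_of_pos (by positivity : 0 < ((k : ℝ) + 1) ^ 2)]
      calc _ ≤ 1 / ((k : ℝ) + 1) ^ 2 * (1 / (k.factorial : ℝ) ^ 2) := by gcongr
        _ = _ := by
          rw [Nat.factorial_succ]
          push_cast
          field_simp

theorem tendsto_mul_succ_atTop : Tendsto (fun m : ℕ => (m : ℝ) * (m + 1)) atTop atTop :=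
  tendsto_natCast_atTop_atTop.atTop_mul_atTop₀
    (tendsto_natCast_atTop_atTop.atTop_add tendsto_const_nhds)

theorem tendsto_rescaledCoeff (k : ℕ) :
    Tendsto (fun m => rescaledCoeff m k) atTop (𝓝 (besselCoeff k)) := by
  induction k with
  | zero => simp [rescaledCoeff_zero, besselCoeff]
  | succ k ih =>
    have h1 : Tendsto (fun m : ℕ => (k : ℝ) * (k + 1) / ((m : ℝ) * (m + 1))) atTop (𝓝 0) :=
      tendsto_const_nhds.div_atTop tendsto_mul_succ_atTop
    have h2 := ((h1.sub_const 1).div_const (((k : ℝ) + 1) ^ 2)).mul ih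
    rw [zero_sub, ← besselCoeff_succ] at h2
    refine h2.congr' ?_
    filter_upwards [eventually_gt_atTop 0] with m hm using (rescaledCoeff_succ hm k).symm

theorem summable_pow_div_factorial_sq (R : ℝ) :
    Summable fun k : ℕ => 1 / (k.factorial : ℝ) ^ 2 * R ^ k := by
  refine Summable.of_norm_bounded (Real.summable_pow_div_factorial |R|) fun k => ?_
  have h : (1 : ℝ) ≤ k.factorial := by exact_mod_cast k.factorial_pos
  rw [norm_mul, norm_pow, Real.norm_eq_abs R, Real.norm_of_nonneg (by positivity), mul_comm,
    div_eq_mul_inv (|R| ^ k)]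
  have h2 : 1 / (k.factorial : ℝ) ^ 2 ≤ (k.factorial : ℝ)⁻¹ := by
    rw [one_div]
    gcongr
    nlinarith
  gcongr

theorem summable_mul_factorial_sq : Summable fun k : ℕ => (k : ℝ) * (1 / (k.factorial : ℝ) ^ 2) := by
  refine Summable.of_nonneg_of_le (fun k => by positivity) (fun k => ?_)
    (Real.summable_pow_div_factorial 1)
  have h : (k : ℝ) ≤ k.factorial := by exact_mod_cast k.self_le_factorial
  have h0 : (0 : ℝ) < k.factorial := by exact_mod_cast k.factorial_pos
  rw [one_pow, mul_one_div, div_le_div_iff₀ (by positivity) h0]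
  nlinarith

theorem summable_besselSeries (y : ℝ) : Summable fun k => besselCoeff k * y ^ k := by
  refine Summable.of_norm_bounded (summable_pow_div_factorial_sq |y|) fun k => ?_
  rw [norm_mul, Real.norm_eq_abs, abs_besselCoeff, norm_pow, Real.norm_eq_abs]

theorem hasSum_rescaledLegendre (m : ℕ) (y : ℝ) :
    HasSum (fun k => rescaledCoeff m k * y ^ k) (rescaledLegendre m y) := by
  have h : rescaledLegendre m y = ∑ k ∈ Finset.range (m + 1), rescaledCoeff m k * y ^ k := by
    rw [rescaledLegendre, Polynomial.eval_eq_sum_range'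
      (Nat.lt_succ_of_le (realShiftedLegendre_natDegree_le m))]
    refine Finset.sum_congr rfl fun k _ => ?_
    rw [rescaledCoeff, div_pow]
    ring
  rw [h]
  refine hasSum_sum_of_ne_finset_zero fun k hk => ?_
  rw [rescaledCoeff_eq_zero (by simpa using hk), zero_mul]

theorem rescaledLegendre_zero (m : ℕ) : rescaledLegendre m 0 = 1 := by
  simp [rescaledLegendre, realShiftedLegendre_eval_zero]

/-- The derivative of `rescaledLegendre`. -/
noncomputable def rescaledLegendreDeriv (m : ℕ) (y : ℝ) : ℝ :=
  (realShiftedLegendre m).derivative.eval (y / ((m : ℝ) * (m + 1))) / ((m : ℝ) * (m + 1))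

theorem hasSum_rescaledLegendreDeriv_one (m : ℕ) :
    HasSum (fun k => k * rescaledCoeff m k) (rescaledLegendreDeriv m 1) := by
  have h : rescaledLegendreDeriv m 1 = ∑ k ∈ Finset.range (m + 1), k * rescaledCoeff m k := by
    rw [rescaledLegendreDeriv, Polynomial.derivative_eval, Polynomial.sum_over_range' _ (by simp) _
      (Nat.lt_succ_of_le (realShiftedLegendre_natDegree_le m)), Finset.sum_div]
    refine Finset.sum_congr rfl fun k _ => ?_
    rcases k with _ | k
    · simp
    · rw [rescaledCoeff, one_div, Nat.add_sub_cancel, pow_succ _ k, inv_pow]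
      generalize (m : ℝ) * (m + 1) = N
      rw [div_eq_mul_inv, div_eq_mul_inv, mul_inv]
      ring
  rw [h]
  refine hasSum_sum_of_ne_finset_zero fun k hk => ?_
  rw [rescaledCoeff_eq_zero (by simpa using hk), mul_zero]

/-- The error is bounded by ∑ |coefficient difference| R^k, which tends to 0 by dominated
convergence for series. -/
theorem exists_uniform_error (R : ℝ) (hR : 0 ≤ R) : ∃ e : ℕ → ℝ, Tendsto e atTop (𝓝 0) ∧
    ∀ m, 0 < m → ∀ y ∈ Set.Icc 0 R, |rescaledLegendre m y - besselSeries y| ≤ e m := by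
  refine ⟨fun m => ∑' k, |rescaledCoeff m k - besselCoeff k| * R ^ k, ?_, ?_⟩
  · have h := tendsto_tsum_of_dominated_convergence (𝓕 := atTop)
      (f := fun (m : ℕ) (k : ℕ) => |rescaledCoeff m k - besselCoeff k| * R ^ k)
      (g := fun _ => (0 : ℝ)) (bound := fun k => 2 * (1 / (k.factorial : ℝ) ^ 2 * R ^ k))
      ((summable_pow_div_factorial_sq R).mul_left 2) ?_ ?_
    · simpa using h
    · intro k
      have := ((tendsto_rescaledCoeff k).sub_const (besselCoeff k)).abs.mul_const (R ^ k)
      simpa using this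
    · filter_upwards [eventually_gt_atTop 0] with m hm k
      rw [Real.norm_of_nonneg (by positivity), ← mul_assoc]
      gcongr
      have h1 := abs_sub (rescaledCoeff m k) (besselCoeff k)
      rw [abs_besselCoeff] at h1
      linarith [abs_rescaledCoeff_le hm k]
  · intro m hm y hy
    have hs : Summable fun k => |rescaledCoeff m k - besselCoeff k| * R ^ k := by
      refine Summable.of_nonneg_of_le (fun k => by positivity) (fun k => ?_)
        ((summable_pow_div_factorial_sq R).mul_left 2)
      rw [← mul_assoc]
      gcongr
      have h1 := abs_sub (rescaledCoeff m k) (besselCoeff k)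
      rw [abs_besselCoeff] at h1
      linarith [abs_rescaledCoeff_le hm k]
    have h2 := (hasSum_rescaledLegendre m y).sub (summable_besselSeries y).hasSum
    rw [← Real.norm_eq_abs, besselSeries, ← h2.tsum_eq]
    refine tsum_of_norm_bounded hs.hasSum fun k => ?_
    rw [← sub_mul, norm_mul, norm_pow, Real.norm_eq_abs, Real.norm_of_nonneg hy.1]
    gcongr
    exacts [hy.1, hy.2]

theorem tendsto_rescaledLegendre {y : ℝ} (hy : 0 ≤ y) :
    Tendsto (fun m => rescaledLegendre m y) atTop (𝓝 (besselSeries y)) := by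
  obtain ⟨e, he, h⟩ := exists_uniform_error y hy
  rw [tendsto_iff_norm_sub_tendsto_zero]
  refine squeeze_zero' (Eventually.of_forall fun _ => norm_nonneg _) ?_ he
  filter_upwards [eventually_gt_atTop 0] with m hm using h m hm y ⟨hy, le_rfl⟩

/-- The derivative is needed only at y = 1, where the Sonin energy starts. Its limit is used as a
series, never identified with a derivative of `besselSeries`. -/
theorem tendsto_rescaledLegendreDeriv_one :
    Tendsto (fun m => rescaledLegendreDeriv m 1) atTop (𝓝 (∑' k : ℕ, k * besselCoeff k)) := by
  simp only [← (hasSum_rescaledLegendreDeriv_one _).tsum_eq]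
  refine tendsto_tsum_of_dominated_convergence summable_mul_factorial_sq
    (fun k => (tendsto_rescaledCoeff k).const_mul _) ?_
  filter_upwards [eventually_gt_atTop 0] with m hm k
  rw [norm_mul, Real.norm_of_nonneg (by positivity), Real.norm_eq_abs]
  gcongr
  exact abs_rescaledCoeff_le hm k

theorem continuous_besselSeries : Continuous besselSeries := by
  rw [continuous_iff_continuousAt]
  intro y
  have h : ContinuousOn besselSeries (Metric.ball 0 (|y| + 1)) := by
    refine continuousOn_tsum (fun k => by fun_prop)
      (summable_pow_div_factorial_sq (|y| + 1)) fun k z hz => ?_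
    rw [norm_mul, norm_pow, Real.norm_eq_abs (besselCoeff k), abs_besselCoeff]
    gcongr
    simpa using (Metric.mem_ball.mp hz).le
  exact h.continuousAt (Metric.isOpen_ball.mem_nhds (by simp))

/-! ### Alternating-series estimates for the Bessel limit -/

theorem antitone_pow_div_factorial_sq {y : ℝ} (h0 : 0 ≤ y) (h1 : y ≤ 1) :
    Antitone fun k : ℕ => 1 / (k.factorial : ℝ) ^ 2 * y ^ k := by
  refine antitone_nat_of_succ_le fun k => ?_
  have hf : (k.factorial : ℝ) ≤ (k + 1).factorial := by
    exact_mod_cast Nat.factorial_le (Nat.le_succ k)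
  have h2 : (0 : ℝ) < k.factorial := by exact_mod_cast k.factorial_pos
  have h3 : y ^ (k + 1) ≤ y ^ k := pow_le_pow_of_le_one h0 h1 (Nat.le_succ k)
  gcongr

theorem tendsto_partial_sum_besselSeries (y : ℝ) :
    Tendsto (fun n => ∑ k ∈ Finset.range n, (-1) ^ k * (1 / (k.factorial : ℝ) ^ 2 * y ^ k)) atTop
      (𝓝 (besselSeries y)) := by
  refine (summable_besselSeries y).hasSum.tendsto_sum_nat.congr fun n => ?_
  refine Finset.sum_congr rfl fun k _ => ?_
  rw [besselCoeff]
  ring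

theorem one_sub_le_besselSeries {y : ℝ} (h0 : 0 ≤ y) (h1 : y ≤ 1) : 1 - y ≤ besselSeries y := by
  have h := (antitone_pow_div_factorial_sq h0 h1).alternating_series_le_tendsto
    (tendsto_partial_sum_besselSeries y) 1
  simp [Finset.sum_range_succ] at h
  linarith

theorem besselSeries_one_bounds : 2 / 9 ≤ besselSeries 1 ∧ besselSeries 1 ≤ 65 / 288 := by
  have ha := antitone_pow_div_factorial_sq zero_le_one le_rfl
  have h1 := ha.alternating_series_le_tendsto (tendsto_partial_sum_besselSeries 1) 2
  have h2 := ha.tendsto_le_alternating_series (tendsto_partial_sum_besselSeries 1) 2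
  norm_num [Finset.sum_range_succ, Nat.factorial] at h1 h2
  constructor <;> linarith

/-- The k = 0 term vanishes; the negated remainder alternates as 1 - 1/2 + 1/12 - 1/144 + ⋯, with
partial sums 7/12 and 83/144. -/
theorem besselSeries_deriv_one_bounds :
    -(7 / 12) ≤ ∑' k : ℕ, k * besselCoeff k ∧ ∑' k : ℕ, k * besselCoeff k ≤ -(83 / 144) := by
  have hs : Summable fun k : ℕ => (k : ℝ) * besselCoeff k := by
    refine Summable.of_norm_bounded summable_mul_factorial_sq fun k => ?_
    rw [norm_mul, Real.norm_of_nonneg (by positivity), Real.norm_eq_abs, abs_besselCoeff]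
  have ht := ((hasSum_nat_add_iff' 1).mpr hs.hasSum).neg.tendsto_sum_nat
  have ha : Antitone fun k : ℕ => ((k : ℝ) + 1) * (1 / ((k + 1).factorial : ℝ) ^ 2) := by
    refine antitone_nat_of_succ_le fun k => ?_
    rw [Nat.factorial_succ (k + 1)]
    have h2 : (0 : ℝ) < (k + 1).factorial := by exact_mod_cast (k + 1).factorial_pos
    push_cast
    rw [mul_pow, mul_one_div, mul_one_div, div_le_div_iff₀ (by positivity) (by positivity)]
    have h3 : ((k : ℝ) + 1 + 1) ≤ (k + 1) * (k + 1 + 1) ^ 2 := by nlinarith [k.cast_nonneg (α := ℝ)]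
    nlinarith [sq_nonneg ((k + 1).factorial : ℝ)]
  have ht' : Tendsto (fun n => ∑ k ∈ Finset.range n,
      (-1) ^ k * (((k : ℝ) + 1) * (1 / ((k + 1).factorial : ℝ) ^ 2))) atTop
      (𝓝 (-∑' k : ℕ, (k : ℝ) * besselCoeff k)) := by
    convert ht using 2
    · refine Finset.sum_congr rfl fun k _ => ?_
      rw [besselCoeff]
      push_cast
      ring
    · simp
  have h1 := ha.alternating_series_le_tendsto ht' 2
  have h2 := ha.tendsto_le_alternating_series ht' 1
  norm_num [Finset.sum_range_succ, Nat.factorial] at h1 h2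
  constructor <;> linarith

theorem besselSeries_two_neg : besselSeries 2 < 0 := by
  have ht := ((hasSum_nat_add_iff' 1).mpr (summable_besselSeries 2).hasSum).neg.tendsto_sum_nat
  -- At y = 2 the terms begin 1, 2, 1, so they decrease only once the constant term is removed.
  have ha : Antitone fun k : ℕ => 1 / ((k + 1).factorial : ℝ) ^ 2 * (2 : ℝ) ^ (k + 1) := by
    refine antitone_nat_of_succ_le fun k => ?_
    rw [Nat.factorial_succ (k + 1), pow_succ _ (k + 1)]
    have h2 : (0 : ℝ) < (k + 1).factorial := by exact_mod_cast (k + 1).factorial_pos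
    push_cast
    have h3 : 2 ≤ ((k : ℝ) + 1 + 1) ^ 2 := by nlinarith [k.cast_nonneg (α := ℝ)]
    calc _ = 1 / ((k + 1).factorial : ℝ) ^ 2 * (2 : ℝ) ^ (k + 1) * (2 / ((k : ℝ) + 1 + 1) ^ 2) := by
          field_simp
      _ ≤ 1 / ((k + 1).factorial : ℝ) ^ 2 * (2 : ℝ) ^ (k + 1) * 1 := by
          gcongr
          rwa [div_le_one (by positivity)]
      _ = _ := mul_one _
  have ht' : Tendsto (fun n => ∑ k ∈ Finset.range n,
      (-1) ^ k * (1 / ((k + 1).factorial : ℝ) ^ 2 * (2 : ℝ) ^ (k + 1))) atTop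
      (𝓝 (-(besselSeries 2 - 1))) := by
    convert ht using 2
    · refine Finset.sum_congr rfl fun k _ => ?_
      rw [besselCoeff]
      ring
    · simp [besselSeries, besselCoeff]
  have h1 := ha.alternating_series_le_tendsto ht' 2
  norm_num [Finset.sum_range_succ, Nat.factorial] at h1
  linarith

/-! ### Sonin energies and the decay of the oscillations -/

/-- Sonin's energy for the equation `(q w')' + w = 0` with `q = y (1 - ε y)`, written in terms of
`y`, `w = w(y)` and `v = w'(y)`. -/
noncomputable def soninEnergy (ε y w v : ℝ) : ℝ :=
  √(y * (1 - ε * y)) ^ 3 * v ^ 2 + √(y * (1 - ε * y)) * (1 - 2 * ε * y) / 2 * (w * v) +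
    (√(y * (1 - ε * y)) * (1 + ε / 2) + (1 - 2 * ε * y) ^ 2 / (8 * √(y * (1 - ε * y)))) * w ^ 2

/-- The Liouville substitution u = q^(1/4) w, dx = dy/√q gives u_xx + Φu = 0 with Φ = 1 + ε/2 +
q'²/(16q). The energy is u_x² + Φu², and Φ ≥ 1, so it dominates u² = √q w². -/
theorem sqrt_mul_sq_le_soninEnergy {ε y : ℝ} (hε : 0 ≤ ε) (hq : 0 < y * (1 - ε * y)) (w v : ℝ) :
    √(y * (1 - ε * y)) * w ^ 2 ≤ soninEnergy ε y w v := by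
  unfold soninEnergy
  set r := √(y * (1 - ε * y))
  have hr : 0 < r := Real.sqrt_pos.mpr hq
  set d := 1 - 2 * ε * y
  have h : r ^ 3 * v ^ 2 + r * d / 2 * (w * v) + (r * (1 + ε / 2) + d ^ 2 / (8 * r)) * w ^ 2 =
      r * w ^ 2 + (r * (r * v + d * w / (4 * r)) ^ 2 + d ^ 2 * w ^ 2 / (16 * r) +
        r * ε / 2 * w ^ 2) := by
    field_simp
    ring
  rw [h]
  have : 0 ≤ r * (r * v + d * w / (4 * r)) ^ 2 + d ^ 2 * w ^ 2 / (16 * r) + r * ε / 2 * w ^ 2 := by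
    positivity
  linarith

/-- Along solutions the y-derivative of u_x² + Φu² is Φ'(y)u². This is nonpositive as long as q' = 1
- 2εy ≥ 0, that is, up to the equator. -/
theorem soninEnergy_antitoneOn {ε : ℝ} (hε : 0 ≤ ε) {w v v' : ℝ → ℝ}
    (hw : ∀ y, HasDerivAt w (v y) y) (hv : ∀ y, HasDerivAt v (v' y) y)
    (hode : ∀ y, y * (1 - ε * y) * v' y + (1 - 2 * ε * y) * v y + w y = 0) {a b : ℝ} (ha : 0 < a)
    (hb : 2 * ε * b ≤ 1) : AntitoneOn (fun y => soninEnergy ε y (w y) (v y)) (Set.Icc a b) := by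
  have key : ∀ y ∈ Set.Icc a b, ∃ D ≤ 0,
      HasDerivAt (fun y => soninEnergy ε y (w y) (v y)) D y := by
    intro y hy
    have hy0 : 0 < y := ha.trans_le hy.1
    have hd : 0 ≤ 1 - 2 * ε * y := by
      have := mul_le_mul_of_nonneg_left hy.2 (by positivity : 0 ≤ 2 * ε)
      linarith
    have hq : 0 < y * (1 - ε * y) := by
      apply mul_pos hy0
      have : 0 ≤ ε * y := by positivity
      linarith
    have hqd : HasDerivAt (fun y => y * (1 - ε * y)) (1 - 2 * ε * y) y := by
      refine ((hasDerivAt_id' y).fun_mul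
        (((hasDerivAt_id' y).const_mul ε).const_sub 1)).congr_deriv ?_
      ring
    have hr : 0 < √(y * (1 - ε * y)) := Real.sqrt_pos.mpr hq
    have hrd := hqd.sqrt hq.ne'
    have hdd : HasDerivAt (fun y : ℝ => 1 - 2 * ε * y) (-(2 * ε)) y := by
      refine (((hasDerivAt_id' y).const_mul (2 * ε)).const_sub 1).congr_deriv ?_
      ring
    have hE := (((hrd.fun_pow 3).fun_mul ((hv y).fun_pow 2)).fun_add
      (((hrd.fun_mul hdd).div_const 2).fun_mul ((hw y).fun_mul (hv y)))).fun_add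
      (((hrd.mul_const (1 + ε / 2)).fun_add
        ((hdd.fun_pow 2).fun_div (hrd.const_mul 8) (by positivity))).fun_mul ((hw y).fun_pow 2))
    have hode' := hode y
    have hr2 : √(y * (1 - ε * y)) ^ 2 = y * (1 - ε * y) := Real.sq_sqrt hq.le
    refine ⟨-(ε / 4 * (1 - 2 * ε * y) * w y ^ 2 / √(y * (1 - ε * y))) -
      (1 - 2 * ε * y) ^ 3 * w y ^ 2 / (16 * √(y * (1 - ε * y)) ^ 3), ?_, hE.congr_deriv ?_⟩
    · have h1 : 0 ≤ ε / 4 * (1 - 2 * ε * y) * w y ^ 2 / √(y * (1 - ε * y)) := by positivity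
      have h2 : 0 ≤ (1 - 2 * ε * y) ^ 3 * w y ^ 2 / (16 * √(y * (1 - ε * y)) ^ 3) := by positivity
      linarith
    · rw [← hr2] at hode'
      generalize √(y * (1 - ε * y)) = r at *
      generalize 1 - 2 * ε * y = d at *
      have hv' : v' y = -(w y + d * v y) / r ^ 2 := by
        field_simp
        linarith
      rw [hv']
      field_simp
      ring
  choose! D hD0 hD using key
  refine antitoneOn_of_deriv_nonpos (convex_Icc a b)
    (fun y hy => (hD y hy).continuousAt.continuousWithinAt)
    (fun y hy => (hD y (interior_subset hy)).differentiableAt.differentiableWithinAt)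
    fun y hy => ?_
  rw [(hD y (interior_subset hy)).deriv]
  exact hD0 y (interior_subset hy)

/-- The simpler Sonin function w² + q w'² has derivative -q' w'² ≤ 0 and, unlike the energy above,
is regular at y = 0, where it equals w(0)². -/
theorem sq_le_sq_of_ode {ε : ℝ} (hε : 0 ≤ ε) {w v v' : ℝ → ℝ}
    (hw : ∀ y, HasDerivAt w (v y) y) (hv : ∀ y, HasDerivAt v (v' y) y)
    (hode : ∀ y, y * (1 - ε * y) * v' y + (1 - 2 * ε * y) * v y + w y = 0) {y : ℝ} (hy0 : 0 ≤ y)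
    (hy : 2 * ε * y ≤ 1) : w y ^ 2 ≤ w 0 ^ 2 := by
  have hd : ∀ z, HasDerivAt (fun z => w z ^ 2 + z * (1 - ε * z) * v z ^ 2)
      (-((1 - 2 * ε * z) * v z ^ 2)) z := by
    intro z
    have hqd : HasDerivAt (fun y => y * (1 - ε * y)) (1 - 2 * ε * z) z := by
      refine ((hasDerivAt_id' z).fun_mul
        (((hasDerivAt_id' z).const_mul ε).const_sub 1)).congr_deriv ?_
      ring
    refine (((hw z).fun_pow 2).fun_add (hqd.fun_mul ((hv z).fun_pow 2))).congr_deriv ?_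
    simp only [Nat.cast_ofNat, Nat.add_one_sub_one, pow_one]
    linear_combination 2 * v z * hode z
  have hanti : AntitoneOn (fun z => w z ^ 2 + z * (1 - ε * z) * v z ^ 2) (Set.Icc 0 y) := by
    refine antitoneOn_of_deriv_nonpos (convex_Icc 0 y)
      (fun z _ => (hd z).continuousAt.continuousWithinAt)
      (fun z _ => (hd z).differentiableAt.differentiableWithinAt) fun z hz => ?_
    have hz' := interior_subset hz
    rw [(hd z).deriv, neg_nonpos]
    have := mul_le_mul_of_nonneg_left hz'.2 (by positivity : 0 ≤ 2 * ε)
    exact mul_nonneg (by linarith) (sq_nonneg _)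
  have h := hanti ⟨le_rfl, hy0⟩ ⟨hy0, le_rfl⟩ hy0
  have : 0 ≤ y * (1 - ε * y) * v y ^ 2 := by
    have : 0 ≤ ε * y := by positivity
    exact mul_nonneg (mul_nonneg hy0 (by linarith)) (sq_nonneg _)
  simp only [zero_mul, add_zero] at h
  linarith

theorem hasDerivAt_rescaledLegendre (m : ℕ) (y : ℝ) :
    HasDerivAt (rescaledLegendre m) (rescaledLegendreDeriv m y) y := by
  have h := ((realShiftedLegendre m).hasDerivAt (y / ((m : ℝ) * (m + 1)))).comp y
    ((hasDerivAt_id' y).div_const _)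
  exact h.congr_deriv (by rw [rescaledLegendreDeriv]; ring)

theorem hasDerivAt_rescaledLegendreDeriv (m : ℕ) (y : ℝ) :
    HasDerivAt (rescaledLegendreDeriv m)
      ((realShiftedLegendre m).derivative.derivative.eval (y / ((m : ℝ) * (m + 1))) /
        ((m : ℝ) * (m + 1)) ^ 2) y := by
  have h := (((realShiftedLegendre m).derivative.hasDerivAt (y / ((m : ℝ) * (m + 1)))).comp y
    ((hasDerivAt_id' y).div_const _)).div_const ((m : ℝ) * (m + 1))
  refine h.congr_deriv ?_
  generalize (m : ℝ) * (m + 1) = N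
  rw [div_eq_mul_inv, div_eq_mul_inv _ (N ^ 2), one_div]
  ring

theorem rescaledLegendre_ode {m : ℕ} (hm : 0 < m) (y : ℝ) :
    y * (1 - ((m : ℝ) * (m + 1))⁻¹ * y) *
      ((realShiftedLegendre m).derivative.derivative.eval (y / ((m : ℝ) * (m + 1))) /
        ((m : ℝ) * (m + 1)) ^ 2) +
      (1 - 2 * ((m : ℝ) * (m + 1))⁻¹ * y) * rescaledLegendreDeriv m y + rescaledLegendre m y = 0 := by
  have h := realShiftedLegendre_eval_ode m (y / ((m : ℝ) * (m + 1)))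
  have hm' : (0 : ℝ) < m := by exact_mod_cast hm
  have hN : (m : ℝ) * (m + 1) ≠ 0 := by positivity
  rw [rescaledLegendreDeriv, rescaledLegendre]
  generalize (m : ℝ) * (m + 1) = N at *
  field_simp at h ⊢
  linarith

theorem abs_rescaledLegendre_le_one {m : ℕ} (hm : 0 < m) {y : ℝ} (h0 : 0 ≤ y)
    (h1 : y ≤ (m : ℝ) * (m + 1) / 2) : |rescaledLegendre m y| ≤ 1 := by
  have hm' : (0 : ℝ) < m := by exact_mod_cast hm
  have hN : 0 < (m : ℝ) * (m + 1) := by positivity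
  have h := sq_le_sq_of_ode (ε := ((m : ℝ) * (m + 1))⁻¹) (by positivity)
    (hasDerivAt_rescaledLegendre m) (hasDerivAt_rescaledLegendreDeriv m) (rescaledLegendre_ode hm)
    h0 (by rw [mul_right_comm, ← div_eq_mul_inv, div_le_one hN]; linarith)
  rw [rescaledLegendre_zero] at h
  exact abs_le_of_sq_le_sq (by simpa using h) zero_le_one

theorem sqrt_mul_sq_rescaledLegendre_le {m : ℕ} (hm : 0 < m) {y : ℝ} (h0 : 1 ≤ y)
    (h1 : y ≤ (m : ℝ) * (m + 1) / 2) :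
    √(y * (1 - ((m : ℝ) * (m + 1))⁻¹ * y)) * rescaledLegendre m y ^ 2 ≤
      soninEnergy ((m : ℝ) * (m + 1))⁻¹ 1 (rescaledLegendre m 1) (rescaledLegendreDeriv m 1) := by
  have hm' : (0 : ℝ) < m := by exact_mod_cast hm
  have hN : 0 < (m : ℝ) * (m + 1) := by positivity
  have hb : 2 * ((m : ℝ) * (m + 1))⁻¹ * y ≤ 1 := by
    rw [mul_right_comm, ← div_eq_mul_inv, div_le_one hN]
    linarith
  have h := soninEnergy_antitoneOn (ε := ((m : ℝ) * (m + 1))⁻¹) (by positivity)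
    (hasDerivAt_rescaledLegendre m) (hasDerivAt_rescaledLegendreDeriv m) (rescaledLegendre_ode hm)
    one_pos hb ⟨le_rfl, h0⟩ ⟨h0, le_rfl⟩ h0
  refine (sqrt_mul_sq_le_soninEnergy (by positivity) ?_ _ _).trans h
  exact mul_pos (by linarith) (by linarith)

theorem tendsto_soninEnergy {ι : Type*} {l : Filter ι} {e w v : ι → ℝ} {w₀ v₀ : ℝ}
    (he : Tendsto e l (𝓝 0)) (hw : Tendsto w l (𝓝 w₀)) (hv : Tendsto v l (𝓝 v₀)) :
    Tendsto (fun i => soninEnergy (e i) 1 (w i) (v i)) l (𝓝 (soninEnergy 0 1 w₀ v₀)) := by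
  have hr : Tendsto (fun i => √(1 * (1 - e i * 1))) l (𝓝 √(1 * (1 - 0 * 1))) :=
    (((he.mul_const 1).const_sub 1).const_mul 1).sqrt
  have hd : Tendsto (fun i => 1 - 2 * e i * 1) l (𝓝 (1 - 2 * 0 * 1)) :=
    ((he.const_mul 2).mul_const 1).const_sub 1
  exact (((hr.pow 3).mul (hv.pow 2)).add (((hr.mul hd).div_const 2).mul (hw.mul hv))).add
    (((hr.mul ((he.div_const 2).const_add 1)).add
      ((hd.pow 2).div (hr.const_mul 8) (by simp))).mul (hw.pow 2))

theorem tendsto_soninEnergy_rescaledLegendre :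
    Tendsto (fun m : ℕ => soninEnergy ((m : ℝ) * (m + 1))⁻¹ 1 (rescaledLegendre m 1)
      (rescaledLegendreDeriv m 1)) atTop
      (𝓝 (soninEnergy 0 1 (besselSeries 1) (∑' k : ℕ, k * besselCoeff k))) :=
  tendsto_soninEnergy (tendsto_inv_atTop_zero.comp tendsto_mul_succ_atTop)
    (tendsto_rescaledLegendre zero_le_one) tendsto_rescaledLegendreDeriv_one

/-- The energy here is b² + ab/2 + 9a²/8, with a and b the limiting value and derivative at 1. The
final comparison at exponent 6 needs a constant K with K³ < 1/14, and 2/5 qualifies. -/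
theorem soninEnergy_bessel_lt :
    soninEnergy 0 1 (besselSeries 1) (∑' k : ℕ, k * besselCoeff k) < 2 / 5 := by
  obtain ⟨ha, ha'⟩ := besselSeries_one_bounds
  obtain ⟨hb, hb'⟩ := besselSeries_deriv_one_bounds
  generalize besselSeries 1 = a at *
  generalize ∑' k : ℕ, (k : ℝ) * besselCoeff k = b at *
  norm_num [soninEnergy]
  nlinarith

theorem tendsto_half_mul_succ_atTop : Tendsto (fun m : ℕ => (m : ℝ) * (m + 1) / 2) atTop atTop :=
  tendsto_mul_succ_atTop.atTop_div_const two_pos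

theorem sqrt_mul_sq_besselSeries_le {y : ℝ} (hy : 1 ≤ y) : √y * besselSeries y ^ 2 ≤ 2 / 5 := by
  have h1 : Tendsto (fun m : ℕ => √(y * (1 - ((m : ℝ) * (m + 1))⁻¹ * y)) * rescaledLegendre m y ^ 2)
      atTop (𝓝 (√(y * (1 - 0 * y)) * besselSeries y ^ 2)) :=
    ((((tendsto_inv_atTop_zero.comp tendsto_mul_succ_atTop).mul_const y).const_sub 1).const_mul
      y).sqrt.mul ((tendsto_rescaledLegendre (by linarith)).pow 2)
  have h2 := le_of_tendsto_of_tendsto h1 tendsto_soninEnergy_rescaledLegendre (by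
    filter_upwards [eventually_gt_atTop 0, tendsto_half_mul_succ_atTop.eventually_ge_atTop y]
      with m hm hmy using sqrt_mul_sq_rescaledLegendre_le hm hy hmy)
  simp only [zero_mul, sub_zero, mul_one] at h2
  exact h2.trans soninEnergy_bessel_lt.le

theorem abs_besselSeries_le_one {y : ℝ} (hy : 0 ≤ y) : |besselSeries y| ≤ 1 := by
  refine le_of_tendsto (tendsto_rescaledLegendre hy).abs ?_
  filter_upwards [eventually_gt_atTop 0, tendsto_half_mul_succ_atTop.eventually_ge_atTop y]
    with m hm hmy using abs_rescaledLegendre_le_one hm hy hmy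

/-- For y ≤ N/2, √q ≥ √y/2; replacing √q by √y therefore costs at most a factor 2, and 2 · 2/5 ≤ 1.
-/
theorem eventually_sqrt_mul_sq_rescaledLegendre_le :
    ∀ᶠ m : ℕ in atTop, ∀ y, 1 ≤ y → y ≤ (m : ℝ) * (m + 1) / 2 →
      √y * rescaledLegendre m y ^ 2 ≤ 1 := by
  filter_upwards [eventually_gt_atTop 0,
    tendsto_soninEnergy_rescaledLegendre.eventually (gt_mem_nhds soninEnergy_bessel_lt)]
    with m hm hE y h0 h1
  have h := (sqrt_mul_sq_rescaledLegendre_le hm h0 h1).trans hE.le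
  have hm' : (0 : ℝ) < m := by exact_mod_cast hm
  have hN : 0 < (m : ℝ) * (m + 1) := by positivity
  have hb : ((m : ℝ) * (m + 1))⁻¹ * y ≤ 1 / 2 := by
    rw [mul_comm, ← div_eq_mul_inv, div_le_iff₀ hN]
    linarith
  have h2 : √y / 2 ≤ √(y * (1 - ((m : ℝ) * (m + 1))⁻¹ * y)) := by
    apply Real.le_sqrt_of_sq_le
    rw [div_pow, Real.sq_sqrt (by linarith)]
    nlinarith
  nlinarith [sq_nonneg (rescaledLegendre m y)]

/-! ### Convergence of the L^p integrals -/

theorem abs_le_rpow_of_sqrt_mul_sq_le {K y w : ℝ} (hy : 0 < y)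
    (h : √y * w ^ 2 ≤ K) {a : ℝ} (ha : 0 ≤ a) : |w| ^ a ≤ K ^ (a / 2) * y ^ (-(a / 4)) := by
  have hs : 0 < √y := Real.sqrt_pos.mpr hy
  have hK : 0 ≤ K := le_trans (by positivity) h
  have h1 : w ^ 2 ≤ K * y ^ (-(1 / 2) : ℝ) := by
    rw [Real.rpow_neg hy.le, ← Real.sqrt_eq_rpow, ← div_eq_mul_inv, le_div_iff₀ hs]
    linarith
  calc |w| ^ a = (w ^ 2) ^ (a / 2) := by
        rw [← sq_abs, ← Real.rpow_natCast, ← Real.rpow_mul (abs_nonneg w)]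
        congr 1
        push_cast
        ring
    _ ≤ (K * y ^ (-(1 / 2) : ℝ)) ^ (a / 2) := by gcongr
    _ = K ^ (a / 2) * y ^ (-(a / 4)) := by
        rw [Real.mul_rpow hK (by positivity), ← Real.rpow_mul hy.le]
        congr 2
        ring

/-- The integrable envelope of the rescaled Legendre polynomials to the power `a`. -/
noncomputable def envelope (a y : ℝ) : ℝ :=
  (Set.Ioc (0 : ℝ) 1).indicator (fun _ => 1) y + (Set.Ioi (1 : ℝ)).indicator (fun y => y ^ (-(a / 4))) y

theorem integrable_envelope {a : ℝ} (ha : 4 < a) : Integrable (envelope a) :=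
  ((integrableOn_const (by simp)).integrable_indicator measurableSet_Ioc).add
    ((integrableOn_Ioi_rpow_of_lt (by linarith) one_pos).integrable_indicator measurableSet_Ioi)

theorem abs_rpow_le_envelope {a y w : ℝ} (ha : 0 ≤ a) (hy : 0 < y) (h1 : |w| ≤ 1)
    (h2 : 1 ≤ y → √y * w ^ 2 ≤ 1) : |w| ^ a ≤ envelope a y := by
  rcases le_or_gt y 1 with h | h
  · simpa [envelope, hy, h] using Real.rpow_le_one (abs_nonneg w) h1 ha
  · simpa [envelope, h, hy] using abs_le_rpow_of_sqrt_mul_sq_le hy (h2 h.le) ha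

theorem max_mul_zero_le_abs {s : ℝ} (hs : |s| = 1) (w : ℝ) : max (s * w) 0 ≤ |w| := by
  refine max_le ((le_abs_self _).trans ?_) (abs_nonneg w)
  rw [abs_mul, hs, one_mul]

/-- The sign `s` selects the positive or negative part. Cutting off at N/2 by an indicator puts all
integrals on one half-line, where `envelope` dominates. -/
theorem tendsto_integral_rescaledLegendre_part {s : ℝ} (hs : |s| = 1) {a : ℝ} (ha : 4 < a) :
    Tendsto (fun m : ℕ => ∫ y in (0 : ℝ)..(m : ℝ) * (m + 1) / 2,
        max (s * rescaledLegendre m y) 0 ^ a) atTop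
      (𝓝 (∫ y in Set.Ioi (0 : ℝ), max (s * besselSeries y) 0 ^ a)) := by
  have ha0 : 0 ≤ a := by linarith
  have h := tendsto_integral_filter_of_dominated_convergence
    (μ := volume.restrict (Set.Ioi (0 : ℝ))) (l := atTop)
    (F := fun (m : ℕ) => (Set.Iic ((m : ℝ) * (m + 1) / 2)).indicator
      fun y => max (s * rescaledLegendre m y) 0 ^ a)
    (f := fun y => max (s * besselSeries y) 0 ^ a) (envelope a) ?_ ?_
    (integrable_envelope ha).integrableOn ?_
  · refine h.congr fun m => ?_
    rw [setIntegral_indicator measurableSet_Iic, Set.Ioi_inter_Iic,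
      intervalIntegral.integral_of_le (by positivity)]
  · refine Eventually.of_forall fun m => ?_
    have : Continuous (rescaledLegendre m) :=
      continuous_iff_continuousAt.mpr fun y => (hasDerivAt_rescaledLegendre m y).continuousAt
    have h2 : Continuous fun y => max (s * rescaledLegendre m y) 0 ^ a :=
      ((continuous_const.mul this).max continuous_const).rpow_const fun _ => Or.inr ha0
    exact (h2.measurable.indicator measurableSet_Iic).aestronglyMeasurable
  · filter_upwards [eventually_gt_atTop 0, eventually_sqrt_mul_sq_rescaledLegendre_le] with m hm hE
    refine (ae_restrict_iff' measurableSet_Ioi).mpr (Eventually.of_forall fun y hy => ?_)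
    have hy' : 0 < y := hy
    by_cases hym : y ≤ (m : ℝ) * (m + 1) / 2
    · rw [Set.indicator_of_mem (Set.mem_Iic.mpr hym), Real.norm_of_nonneg (by positivity)]
      exact (Real.rpow_le_rpow (le_max_right _ _) (max_mul_zero_le_abs hs _) ha0).trans
        (abs_rpow_le_envelope ha0 hy' (abs_rescaledLegendre_le_one hm hy'.le hym)
          fun h1 => hE y h1 hym)
    · rw [Set.indicator_of_notMem (by simpa using hym), norm_zero]
      unfold envelope
      refine add_nonneg (Set.indicator_nonneg (by simp) y) (Set.indicator_nonneg ?_ y)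
      intro z hz
      have : (0 : ℝ) < z := one_pos.trans hz
      positivity
  · refine (ae_restrict_iff' measurableSet_Ioi).mpr (Eventually.of_forall fun y hy => ?_)
    have h1 := (((tendsto_rescaledLegendre (le_of_lt hy)).const_mul s).max
      (tendsto_const_nhds (x := (0 : ℝ)))).rpow_const (p := a) (Or.inr ha0)
    refine h1.congr' ?_
    filter_upwards [tendsto_half_mul_succ_atTop.eventually_ge_atTop y] with m hm
    rw [Set.indicator_of_mem (Set.mem_Iic.mpr hm)]

theorem continuous_besselSeries_part (s : ℝ) {a : ℝ} (ha : 0 ≤ a) :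
    Continuous fun y => max (s * besselSeries y) 0 ^ a :=
  ((continuous_const.mul continuous_besselSeries).max continuous_const).rpow_const
    fun _ => Or.inr ha

theorem integrableOn_besselSeries_part {s : ℝ} (hs : |s| = 1) {a : ℝ} (ha : 4 < a) :
    IntegrableOn (fun y => max (s * besselSeries y) 0 ^ a) (Set.Ioi 0) := by
  have ha0 : 0 ≤ a := by linarith
  refine (integrable_envelope ha).integrableOn.mono'
    (continuous_besselSeries_part s ha0).aestronglyMeasurable ?_
  refine (ae_restrict_iff' measurableSet_Ioi).mpr (Eventually.of_forall fun y hy => ?_)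
  rw [Real.norm_of_nonneg (by positivity)]
  exact (Real.rpow_le_rpow (le_max_right _ _) (max_mul_zero_le_abs hs _) ha0).trans
    (abs_rpow_le_envelope ha0 hy (abs_besselSeries_le_one (le_of_lt hy))
      fun h1 => (sqrt_mul_sq_besselSeries_le h1).trans (by norm_num))

/-! ### Positive against negative part of the Bessel limit -/

theorem integral_besselSeries_neg_part_pos {a : ℝ} (ha : 4 < a) :
    0 < ∫ y in Set.Ioi (0 : ℝ), max (-1 * besselSeries y) 0 ^ a := by
  rw [integral_pos_iff_support_of_nonneg (fun y => by positivity)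
    (integrableOn_besselSeries_part (by simp) ha)]
  have ho : IsOpen ({y | besselSeries y < 0} ∩ Set.Ioi 0) :=
    (isOpen_lt continuous_besselSeries continuous_const).inter isOpen_Ioi
  rw [Measure.restrict_apply' measurableSet_Ioi]
  refine (ho.measure_pos volume ⟨2, besselSeries_two_neg, by simp⟩).trans_le (measure_mono ?_)
  rintro y ⟨hy, hy0⟩
  have hy' : besselSeries y < 0 := hy
  have : 0 < max (-1 * besselSeries y) 0 := lt_max_of_lt_left (by linarith)
  exact ⟨(Real.rpow_pos_of_pos this a).ne', hy0⟩

/-- There is no negative part on [0,1], by the bound 1 - y; on y > 1 the Sonin bound leaves an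
explicit power integral. -/
theorem integral_besselSeries_neg_part_le {a : ℝ} (ha : 4 < a) :
    ∫ y in Set.Ioi (0 : ℝ), max (-1 * besselSeries y) 0 ^ a ≤ (2 / 5) ^ (a / 2) / (a / 4 - 1) := by
  have ha0 : 0 < a := by linarith
  have hi := integrableOn_besselSeries_part (s := -1) (by simp) ha
  have h0 : ∫ y in Set.Ioi (0 : ℝ), max (-1 * besselSeries y) 0 ^ a =
      ∫ y in Set.Ioi (1 : ℝ), max (-1 * besselSeries y) 0 ^ a := by
    refine setIntegral_eq_of_subset_of_forall_sdiff_eq_zero measurableSet_Ioi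
      (Set.Ioi_subset_Ioi zero_le_one) fun y hy => ?_
    have hy0 : 0 ≤ y := le_of_lt hy.1
    have hy1 : y ≤ 1 := not_lt.mp hy.2
    rw [max_eq_right (by linarith [one_sub_le_besselSeries hy0 hy1]), Real.zero_rpow ha0.ne']
  have h1 : ∫ y in Set.Ioi (1 : ℝ), (2 / 5 : ℝ) ^ (a / 2) * y ^ (-(a / 4)) =
      (2 / 5) ^ (a / 2) / (a / 4 - 1) := by
    rw [integral_const_mul, integral_Ioi_rpow_of_lt (by linarith) one_pos, Real.one_rpow,
      show -(a / 4) + 1 = -(a / 4 - 1) by ring, neg_div_neg_eq, mul_one_div]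
  rw [h0, ← h1]
  refine setIntegral_mono_on (hi.mono_set (Set.Ioi_subset_Ioi zero_le_one))
    ((integrableOn_Ioi_rpow_of_lt (by linarith) one_pos).const_mul _) measurableSet_Ioi
    fun y hy => ?_
  have hy1 : 1 < y := hy
  exact (Real.rpow_le_rpow (le_max_right _ _) (max_mul_zero_le_abs (by simp) _) ha0.le).trans
    (abs_le_rpow_of_sqrt_mul_sq_le (by linarith) (sqrt_mul_sq_besselSeries_le hy1.le) ha0.le)

theorem le_integral_besselSeries_pos_part {a : ℝ} (ha : 4 < a) :
    1 / (a + 1) ≤ ∫ y in Set.Ioi (0 : ℝ), max (1 * besselSeries y) 0 ^ a := by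
  have ha0 : 0 < a := by linarith
  have hi := integrableOn_besselSeries_part (s := 1) (by simp) ha
  have h1 : ∫ y in (0 : ℝ)..1, (1 - y) ^ a = 1 / (a + 1) := by
    rw [intervalIntegral.integral_comp_sub_left (fun y => y ^ a), sub_self, sub_zero,
      integral_rpow (Or.inl (by linarith)), Real.one_rpow, Real.zero_rpow (by linarith), sub_zero]
  have hc : Continuous fun y : ℝ => (1 - y) ^ a :=
    (continuous_const.sub continuous_id).rpow_const fun _ => Or.inr ha0.le
  have hsub : Set.Ioc (0 : ℝ) 1 ⊆ Set.Ioi 0 := fun y hy => hy.1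
  rw [← h1, intervalIntegral.integral_of_le zero_le_one]
  refine (setIntegral_mono_on (hc.integrableOn_Ioc) (hi.mono_set hsub) measurableSet_Ioc
    fun y hy => ?_).trans (setIntegral_mono_set hi (Eventually.of_forall fun y => by positivity)
      (LE.le.eventuallyLE hsub))
  refine Real.rpow_le_rpow (by linarith [hy.2]) (le_max_of_le_left ?_) ha0.le
  linarith [one_sub_le_besselSeries hy.1.le hy.2]

/-- With (2/5)^(a/2) ≤ 8/125, it remains to check 8(a+1)/125 < a/4 - 1; at a = 6 this reads 56/125 <
1/2. -/
theorem integral_besselSeries_neg_part_lt_pos_part {a : ℝ} (ha : 6 ≤ a) :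
    ∫ y in Set.Ioi (0 : ℝ), max (-1 * besselSeries y) 0 ^ a <
      ∫ y in Set.Ioi (0 : ℝ), max (1 * besselSeries y) 0 ^ a := by
  refine (integral_besselSeries_neg_part_le (by linarith)).trans_lt
    (lt_of_lt_of_le ?_ (le_integral_besselSeries_pos_part (by linarith)))
  have h : (2 / 5 : ℝ) ^ (a / 2) ≤ (2 / 5) ^ (3 : ℝ) :=
    Real.rpow_le_rpow_of_exponent_ge (by norm_num) (by norm_num) (by linarith)
  have h3 : (2 / 5 : ℝ) ^ (3 : ℝ) = 8 / 125 := by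
    rw [show (3 : ℝ) = (3 : ℕ) by norm_num, Real.rpow_natCast]
    norm_num
  rw [h3] at h
  rw [div_lt_div_iff₀ (by linarith) (by linarith)]
  nlinarith

/-! ### Norms of zonal functions on the sphere -/

theorem exists_sphereLpNorm_coord : ∃ C : ℝ, 0 < C ∧ ∀ (p : ℝ≥0∞), p ≠ 0 → p ≠ ⊤ →
    ∀ g : ℝ → ℝ, Continuous g → (∀ t, 0 ≤ g t) →
      sphereLpNorm (fun x => g ((x : EuclideanSpace ℝ (Fin 3)) 2)) p =
        (C * ∫ t in (-1 : ℝ)..1, g t ^ p.toReal) ^ (1 / p.toReal) := by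
  obtain ⟨c, hc0, hc, hmap⟩ := exists_map_coord_surfaceMeasure
  refine ⟨c.toReal, ENNReal.toReal_pos hc0 hc, fun p hp0 hp g hg hg0 => ?_⟩
  have hm : Measurable (fun x : S2 => (x : EuclideanSpace ℝ (Fin 3)) 2) := by fun_prop
  have hga : Continuous fun t => g t ^ p.toReal :=
    hg.rpow_const fun _ => Or.inr ENNReal.toReal_nonneg
  have hF : Measurable fun t => ENNReal.ofReal (g t ^ p.toReal) := hga.measurable.ennreal_ofReal
  have h1 : ∫⁻ x : S2, ‖g ((x : EuclideanSpace ℝ (Fin 3)) 2)‖ₑ ^ p.toReal ∂surfaceMeasure =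
      c * ENNReal.ofReal (∫ t in (-1 : ℝ)..1, g t ^ p.toReal) := by
    have h2 : ∀ x : S2, ‖g ((x : EuclideanSpace ℝ (Fin 3)) 2)‖ₑ ^ p.toReal =
        ENNReal.ofReal (g ((x : EuclideanSpace ℝ (Fin 3)) 2) ^ p.toReal) := by
      intro x
      rw [Real.enorm_eq_ofReal (hg0 _), ENNReal.ofReal_rpow_of_nonneg (hg0 _) ENNReal.toReal_nonneg]
    simp only [h2]
    rw [← lintegral_map hF hm, hmap, lintegral_smul_measure, smul_eq_mul,
      intervalIntegral.integral_of_le (by norm_num), integral_Ioc_eq_integral_Ioo,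
      ofReal_integral_eq_lintegral_ofReal (hga.integrableOn_Icc.mono_set Set.Ioo_subset_Icc_self)
        (Eventually.of_forall fun t => Real.rpow_nonneg (hg0 t) _)]
  rw [sphereLpNorm, eLpNorm_eq_lintegral_rpow_enorm_toReal hp0 hp, h1, ← ENNReal.toReal_rpow,
    ENNReal.toReal_mul, ENNReal.toReal_ofReal]
  exact intervalIntegral.integral_nonneg (by norm_num) fun t _ => Real.rpow_nonneg (hg0 t) _

theorem sphereLpNorm_top_le {f : S2 → ℝ} {M : ℝ} (hM : 0 ≤ M) (hf : ∀ x, |f x| ≤ M) :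
    sphereLpNorm f ⊤ ≤ M := by
  rw [sphereLpNorm, eLpNorm_exponent_top]
  exact ENNReal.toReal_le_of_le_ofReal hM
    (eLpNormEssSup_le_of_ae_bound (Eventually.of_forall fun x => hf x))

/-- Nonempty open sets have positive measure, so a continuous function cannot exceed its essential
supremum at a point. -/
theorem abs_le_sphereLpNorm_top {f : S2 → ℝ} (hf : Continuous f) (x : S2) :
    |f x| ≤ sphereLpNorm f ⊤ := by
  obtain ⟨M, hM⟩ := isCompact_univ.exists_bound_of_continuousOn hf.continuousOn
  have hfin : eLpNormEssSup f surfaceMeasure < ⊤ :=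
    eLpNormEssSup_lt_top_of_ae_bound (Eventually.of_forall fun x => hM x trivial)
  rw [sphereLpNorm, eLpNorm_exponent_top]
  by_contra! hlt
  set K := (eLpNormEssSup f surfaceMeasure).toReal with hK
  have ho : IsOpen {z | K < |f z|} := isOpen_lt continuous_const hf.abs
  have hae := enorm_ae_le_eLpNormEssSup f surfaceMeasure
  refine (ho.measure_pos surfaceMeasure ⟨x, hlt⟩).ne' (measure_mono_null (fun z hz => ?_) hae)
  have hz' : K < |f z| := hz
  simp only [Set.mem_compl_iff, Set.mem_ofPred_eq, not_le]
  rw [← ENNReal.ofReal_toReal hfin.ne, ← ofReal_norm, Real.norm_eq_abs]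
  exact (ENNReal.ofReal_lt_ofReal_iff ((ENNReal.toReal_nonneg).trans_lt hz')).mpr hz'

theorem legendreP_eval_eq_rescaledLegendre {m : ℕ} (hm : 0 < m) (t : ℝ) :
    (legendreP m).eval t = rescaledLegendre m ((m : ℝ) * (m + 1) / 2 * (1 - t)) := by
  have hm' : (0 : ℝ) < m := by exact_mod_cast hm
  rw [legendreP_eval, rescaledLegendre]
  congr 1
  field_simp

theorem legendreP_eval_neg {m : ℕ} (hm : Even m) (t : ℝ) :
    (legendreP m).eval (-t) = (legendreP m).eval t := by
  rw [legendreP_eval, legendreP_eval, realShiftedLegendre_eval_symm, hm.neg_one_pow, one_mul]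
  congr 1
  ring

/-- Parity doubles the integral over [0,1], and dt = (2/N) dy in absolute value, whence 4/N. -/
theorem integral_even_legendreP_part {m : ℕ} (hm : 0 < m) (hm2 : Even m) (G : ℝ → ℝ)
    (hG : Continuous G) :
    ∫ t in (-1 : ℝ)..1, G ((legendreP m).eval t) =
      4 / ((m : ℝ) * (m + 1)) * ∫ y in (0 : ℝ)..(m : ℝ) * (m + 1) / 2, G (rescaledLegendre m y) := by
  have hm' : (0 : ℝ) < m := by exact_mod_cast hm
  set N := (m : ℝ) * (m + 1) with hN
  have hN0 : 0 < N := by positivity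
  have hc : Continuous fun t => G ((legendreP m).eval t) := hG.comp (legendreP m).continuous
  have h1 : ∫ t in (-1 : ℝ)..0, G ((legendreP m).eval t) =
      ∫ t in (0 : ℝ)..1, G ((legendreP m).eval t) := by
    have h := intervalIntegral.integral_comp_neg (a := 0) (b := 1)
      fun t => G ((legendreP m).eval t)
    simp only [legendreP_eval_neg hm2, neg_zero] at h
    exact h.symm
  have h2 := intervalIntegral.integral_comp_sub_mul (a := 0) (b := N / 2)
    (fun t => G ((legendreP m).eval t)) (c := 2 / N) (by positivity) 1
  have h3 : ∀ y, rescaledLegendre m y = (legendreP m).eval (1 - 2 / N * y) := by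
    intro y
    rw [legendreP_eval_eq_rescaledLegendre hm, ← hN]
    congr 1
    field_simp
    ring
  have e1 : 1 - 2 / N * (N / 2) = 0 := by
    field_simp
    ring
  rw [e1, mul_zero, sub_zero, smul_eq_mul] at h2
  simp only [h3]
  rw [h2, ← intervalIntegral.integral_add_adjacent_intervals (hc.intervalIntegrable (-1) 0)
    (hc.intervalIntegrable 0 1), h1]
  field_simp
  ring

theorem abs_legendreP_eval_le_one {m : ℕ} (hm : 0 < m) (hm2 : Even m) {t : ℝ}
    (ht : t ∈ Set.Icc (-1 : ℝ) 1) : |(legendreP m).eval t| ≤ 1 := by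
  have hm' : (0 : ℝ) < m := by exact_mod_cast hm
  have hN0 : 0 < (m : ℝ) * (m + 1) / 2 := by positivity
  wlog h : 0 ≤ t generalizing t
  · rw [← legendreP_eval_neg hm2]
    exact this ⟨by linarith [ht.2], by linarith [ht.1]⟩ (by linarith)
  rw [legendreP_eval_eq_rescaledLegendre hm]
  exact abs_rescaledLegendre_le_one hm (mul_nonneg hN0.le (by linarith [ht.2]))
    (mul_le_of_le_one_right hN0.le (by linarith))

theorem sphere_coord_mem (x : S2) : (x : EuclideanSpace ℝ (Fin 3)) 2 ∈ Set.Icc (-1 : ℝ) 1 := by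
  have h := PiLp.norm_apply_le (x : EuclideanSpace ℝ (Fin 3)) 2
  rw [norm_eq_of_mem_sphere, Real.norm_eq_abs] at h
  exact abs_le.mp h

theorem continuous_zonalHarmonic (m : ℕ) : Continuous (zonalHarmonic m) :=
  (contMDiff_zonalHarmonic m).continuous

theorem exists_zonalHarmonic_eq_rescaledLegendre {m : ℕ} (hm : 0 < m) {y : ℝ} (h0 : 0 ≤ y)
    (h1 : y ≤ (m : ℝ) * (m + 1) / 2) : ∃ x, zonalHarmonic m x = rescaledLegendre m y := by
  have hm' : (0 : ℝ) < m := by exact_mod_cast hm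
  have hN : 0 < (m : ℝ) * (m + 1) / 2 := by positivity
  obtain ⟨x, hx⟩ := exists_sphere_coord_eq (t := 1 - y / ((m : ℝ) * (m + 1) / 2)) (by
    have h2 : y / ((m : ℝ) * (m + 1) / 2) ≤ 1 := (div_le_one hN).mpr h1
    have h3 : 0 ≤ y / ((m : ℝ) * (m + 1) / 2) := by positivity
    constructor <;> linarith)
  refine ⟨x, ?_⟩
  rw [zonalHarmonic, hx, legendreP_eval_eq_rescaledLegendre hm, sub_sub_cancel,
    mul_div_cancel₀ _ hN.ne']

theorem exists_rescaledLegendre_eq_zonalHarmonic {m : ℕ} (hm : 0 < m) (hm2 : Even m) (x : S2) :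
    ∃ y, 0 ≤ y ∧ y ≤ (m : ℝ) * (m + 1) / 2 ∧ zonalHarmonic m x = rescaledLegendre m y := by
  have hm' : (0 : ℝ) < m := by exact_mod_cast hm
  have hN0 : 0 < (m : ℝ) * (m + 1) / 2 := by positivity
  have key : ∀ t ∈ Set.Icc (0 : ℝ) 1, ∃ y, 0 ≤ y ∧ y ≤ (m : ℝ) * (m + 1) / 2 ∧
      (legendreP m).eval t = rescaledLegendre m y := fun t ht =>
    ⟨_, mul_nonneg hN0.le (by linarith [ht.2]), mul_le_of_le_one_right hN0.le (by linarith [ht.1]),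
      legendreP_eval_eq_rescaledLegendre hm t⟩
  have hx := sphere_coord_mem x
  rw [zonalHarmonic]
  rcases le_total 0 ((x : EuclideanSpace ℝ (Fin 3)) 2) with h | h
  · exact key _ ⟨h, hx.2⟩
  · rw [← legendreP_eval_neg hm2]
    exact key _ ⟨by linarith, by linarith [hx.1]⟩

/-! ### The case p = ∞ -/

theorem sphereLpNorm_top_zonalHarmonic_pos_part {m : ℕ} (hm : 0 < m) (hm2 : Even m) :
    sphereLpNorm (fun x => max (zonalHarmonic m x) 0) ⊤ = 1 := by
  refine le_antisymm (sphereLpNorm_top_le zero_le_one fun x => ?_) ?_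
  · rw [abs_of_nonneg (le_max_right _ _)]
    exact max_le ((le_abs_self _).trans (abs_legendreP_eval_le_one hm hm2 (sphere_coord_mem x)))
      zero_le_one
  · obtain ⟨x, hx⟩ := exists_sphere_coord_eq (t := 1) (by simp)
    have h := abs_le_sphereLpNorm_top
      ((continuous_zonalHarmonic m).max continuous_const : Continuous fun x =>
        max (zonalHarmonic m x) 0) x
    simpa [zonalHarmonic, hx, legendreP_eval_one] using h

/-- The depth of the first (and deepest) negative well of `J₀`. -/
noncomputable def besselDepth : ℝ := sSup ((fun y => -besselSeries y) '' Set.Ici 0)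

theorem neg_besselSeries_le {y : ℝ} (hy : 0 ≤ y) : -besselSeries y ≤ √(2 / 5) := by
  rcases le_or_gt y 1 with h | h
  · linarith [one_sub_le_besselSeries hy h, Real.sqrt_nonneg (2 / 5)]
  · refine Real.le_sqrt_of_sq_le ?_
    have h1 := sqrt_mul_sq_besselSeries_le h.le
    have h2 : 1 ≤ √y := Real.one_le_sqrt.mpr h.le
    nlinarith [sq_nonneg (besselSeries y)]

theorem neg_besselSeries_le_besselDepth {y : ℝ} (hy : 0 ≤ y) : -besselSeries y ≤ besselDepth :=
  le_csSup ⟨√(2 / 5), by rintro _ ⟨z, hz, rfl⟩; exact neg_besselSeries_le hz⟩ ⟨y, hy, rfl⟩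

theorem besselDepth_pos : 0 < besselDepth :=
  lt_of_lt_of_le (by linarith [besselSeries_two_neg]) (neg_besselSeries_le_besselDepth zero_le_two)

theorem besselDepth_lt_one : besselDepth < 1 := by
  refine lt_of_le_of_lt (csSup_le (Set.nonempty_Ici.image _) ?_)
    ((Real.sqrt_lt' one_pos).mpr (by norm_num : (2 / 5 : ℝ) < 1 ^ 2))
  rintro _ ⟨z, hz, rfl⟩
  exact neg_besselSeries_le hz

/-- Pointwise convergence at a nearly deepest point gives the lower bound. For the upper bound,
uniform convergence handles [0, R] and the Sonin decay handles the rest. -/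
theorem tendsto_sphereLpNorm_top_neg_part {m : ℕ → ℕ} (hm : Tendsto m atTop atTop)
    (hm2 : ∀ n, Even (m n)) :
    Tendsto (fun n => sphereLpNorm (fun x => max (-zonalHarmonic (m n) x) 0) ⊤) atTop
      (𝓝 besselDepth) := by
  refine tendsto_order.mpr ⟨fun b hb => ?_, fun b hb => ?_⟩
  · obtain ⟨_, ⟨y, hy, rfl⟩, hby⟩ := exists_lt_of_lt_csSup (Set.nonempty_Ici.image _) hb
    have h1 := (tendsto_rescaledLegendre (y := y) hy).neg.eventually (lt_mem_nhds hby)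
    filter_upwards [hm.eventually h1, hm.eventually (eventually_gt_atTop 0),
      hm.eventually (tendsto_half_mul_succ_atTop.eventually_ge_atTop y)] with n h2 h3 h4
    obtain ⟨x, hx⟩ := exists_zonalHarmonic_eq_rescaledLegendre h3 hy h4
    have h5 := abs_le_sphereLpNorm_top ((continuous_zonalHarmonic (m n)).fun_neg.max continuous_const :
      Continuous fun x => max (-zonalHarmonic (m n) x) 0) x
    rw [hx] at h5
    exact h2.trans_le ((le_max_left _ _).trans ((le_abs_self _).trans h5))
  · obtain ⟨d, hd, hdb⟩ := exists_between hb
    have hd0 : 0 < d := besselDepth_pos.trans hd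
    -- Beyond this R, √y w² ≤ 1 already forces |w| ≤ d.
    obtain ⟨R, hR1, hR⟩ : ∃ R : ℝ, 1 ≤ R ∧ 1 ≤ √R * d ^ 2 := by
      refine ⟨max 1 ((1 / d ^ 2) ^ 2), le_max_left _ _, ?_⟩
      rw [← div_le_iff₀ (by positivity)]
      exact Real.le_sqrt_of_sq_le (le_max_right _ _)
    obtain ⟨e, he, hee⟩ := exists_uniform_error R (by linarith)
    have h1 := he.eventually (gt_mem_nhds (sub_pos.mpr hd))
    filter_upwards [hm.eventually h1, hm.eventually (eventually_gt_atTop 0),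
      hm.eventually eventually_sqrt_mul_sq_rescaledLegendre_le] with n h2 h3 h4
    refine (sphereLpNorm_top_le hd0.le fun x => ?_).trans_lt hdb
    rw [abs_of_nonneg (le_max_right _ _)]
    refine max_le ?_ hd0.le
    obtain ⟨y, hy0, hyN, hxy⟩ := exists_rescaledLegendre_eq_zonalHarmonic h3 (hm2 n) x
    rw [hxy]
    rcases le_total y R with hyR | hyR
    · have h5 := (abs_le.mp (hee _ h3 y ⟨hy0, hyR⟩)).1
      linarith [neg_besselSeries_le_besselDepth hy0]
    · have h5 := h4 y (hR1.trans hyR) hyN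
      have h6 : √R ≤ √y := Real.sqrt_le_sqrt hyR
      have hR0 : 0 < √R := Real.sqrt_pos.mpr (by linarith)
      have h7 : rescaledLegendre (m n) y ^ 2 ≤ d ^ 2 := by
        by_contra! hlt
        nlinarith [mul_le_mul_of_nonneg_right h6 (sq_nonneg (rescaledLegendre (m n) y)),
          mul_lt_mul_of_pos_left hlt hR0]
      exact (neg_le_abs _).trans (abs_le_of_sq_le_sq h7 hd0.le)

theorem exists_limit_ratio_top {m : ℕ → ℕ} (hm : Tendsto m atTop atTop)
    (hm2 : ∀ n, Even (m n)) : ∃ L : ℝ, 1 < L ∧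
      Tendsto (fun n => sphereLpNorm (fun x => max (zonalHarmonic (m n) x) 0) ⊤ /
        sphereLpNorm (fun x => max (-zonalHarmonic (m n) x) 0) ⊤) atTop (𝓝 L) := by
  refine ⟨1 / besselDepth, (one_lt_div besselDepth_pos).mpr besselDepth_lt_one, ?_⟩
  refine (tendsto_const_nhds.div (tendsto_sphereLpNorm_top_neg_part hm hm2)
    besselDepth_pos.ne').congr' ?_
  filter_upwards [hm.eventually (eventually_gt_atTop 0)] with n hn
  rw [sphereLpNorm_top_zonalHarmonic_pos_part hn (hm2 n), Pi.div_apply]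

/-! ### Finite p and the conclusion -/

theorem exists_limit_ratio_of_ne_top {p : ℝ≥0∞} (hp : 6 ≤ p) (hp' : p ≠ ⊤) {m : ℕ → ℕ}
    (hm : Tendsto m atTop atTop) (hm2 : ∀ n, Even (m n)) : ∃ L : ℝ, 1 < L ∧
      Tendsto (fun n => sphereLpNorm (fun x => max (zonalHarmonic (m n) x) 0) p /
        sphereLpNorm (fun x => max (-zonalHarmonic (m n) x) 0) p) atTop (𝓝 L) := by
  have ha : 6 ≤ p.toReal := by
    simpa using ENNReal.toReal_mono hp' hp
  have hp0 : p ≠ 0 := by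
    rintro rfl
    simp at ha
    linarith
  set a := p.toReal
  have hneg := integral_besselSeries_neg_part_pos (a := a) (by linarith)
  have hlt := integral_besselSeries_neg_part_lt_pos_part ha
  set A := ∫ y in Set.Ioi (0 : ℝ), max (1 * besselSeries y) 0 ^ a
  set B := ∫ y in Set.Ioi (0 : ℝ), max (-1 * besselSeries y) 0 ^ a
  obtain ⟨C, hC, hnorm⟩ := exists_sphereLpNorm_coord
  refine ⟨(A / B) ^ (1 / a), Real.one_lt_rpow ((one_lt_div hneg).mpr hlt) (by positivity), ?_⟩
  have hA := (tendsto_integral_rescaledLegendre_part (s := 1) (by simp)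
    (by linarith : 4 < a)).comp hm
  have hB := (tendsto_integral_rescaledLegendre_part (s := -1) (by simp)
    (by linarith : 4 < a)).comp hm
  have hAB := (hA.div hB hneg.ne').rpow_const (p := 1 / a) (Or.inr (by positivity))
  refine hAB.congr' ?_
  filter_upwards [hm.eventually (eventually_gt_atTop 0)] with n hn
  have hn' : (0 : ℝ) < m n := by exact_mod_cast hn
  have hpart : ∀ s : ℝ, sphereLpNorm (fun x => max (s * zonalHarmonic (m n) x) 0) p =
      (C * (4 / ((m n : ℝ) * (m n + 1))) * ∫ y in (0 : ℝ)..(m n : ℝ) * (m n + 1) / 2,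
        max (s * rescaledLegendre (m n) y) 0 ^ a) ^ (1 / a) := by
    intro s
    have h1 := hnorm p hp0 hp' (fun t => max (s * (legendreP (m n)).eval t) 0)
      ((continuous_const.mul (legendreP (m n)).continuous).max continuous_const)
      fun t => le_max_right _ _
    have h2 := integral_even_legendreP_part hn (hm2 n) (fun w => max (s * w) 0 ^ a)
      (((continuous_const.mul continuous_id).max continuous_const).rpow_const
        fun _ => Or.inr (by positivity))
    rw [mul_assoc, ← h2, ← h1]
    rfl
  have hpos := hpart 1
  have hneg' := hpart (-1)
  have hint : ∀ s : ℝ, 0 ≤ ∫ y in (0 : ℝ)..(m n : ℝ) * (m n + 1) / 2,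
      max (s * rescaledLegendre (m n) y) 0 ^ a := fun s =>
    intervalIntegral.integral_nonneg (by positivity) fun y _ => by positivity
  simp only [one_mul, neg_one_mul] at hpos hneg'
  -- Both parts carry the same factor 4C/N, so the decay in N and the hat-box constant drop out.
  rw [hpos, hneg', ← Real.div_rpow (mul_nonneg (by positivity) (by simpa using hint 1))
    (mul_nonneg (by positivity) (by simpa using hint (-1))), mul_div_mul_left _ _ (by positivity)]
  simp

theorem theorem1p2 (p : ℝ≥0∞) (hp : 6 ≤ p) :
    ∃ (ψ : ℕ → S2 → ℝ) (lam : ℕ → ℝ),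
      (∀ n, ψ n = zonalHarmonic (4 * (n + 1))) ∧
      (∀ n, IsLaplaceEigenfunction (ψ n) (lam n)) ∧
      Tendsto lam atTop atTop ∧
      ∃ L : ℝ, 1 < L ∧
        Tendsto (fun n => sphereLpNorm (fun x => max (ψ n x) 0) p /
          sphereLpNorm (fun x => max (-ψ n x) 0) p) atTop (𝓝 L) := by
  -- The shift n + 1 makes the degrees 4, 8, … while indexing from 0; of divisibility by 4 only
  -- evenness matters.
  have hm : Tendsto (fun n : ℕ => 4 * (n + 1)) atTop atTop :=
    tendsto_atTop_mono (fun n => show n ≤ 4 * (n + 1) by omega) tendsto_id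
  have hm2 : ∀ n : ℕ, Even (4 * (n + 1)) := fun n => ⟨2 * (n + 1), by ring⟩
  refine ⟨fun n => zonalHarmonic (4 * (n + 1)),
    fun n => ((4 * (n + 1) : ℕ) : ℝ) * ((4 * (n + 1) : ℕ) + 1), fun _ => rfl,
    fun n => isLaplaceEigenfunction_zonalHarmonic _, tendsto_mul_succ_atTop.comp hm, ?_⟩
  rcases eq_or_ne p ⊤ with rfl | hp'
  · exact exists_limit_ratio_top hm hm2
  · exact exists_limit_ratio_of_ne_top hp hp' hm hm2
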